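/- Let $\mathbb{D}=\{z\in\mathbb{C}:|z|<1\}$, let $\mathcal{A}$ be the class of analytic functions $f:\mathbb{D}\to\mathbb{C}$ with $f(0)=0$, $f'(0)=1$, and let $s_f(z)=zf'(z)/f(z)$, with $s_f(0)=1$. Let $\mathcal{F}_1$ be the class of all $f\in\mathcal{A}$ for which there is $g\in\mathcal{A}$ with $$\operatorname{Re}\frac{f(z)}{g(z)}>0,\qquad \operatorname{Re}\frac{g(z)}{z+z^2/2}>0\qquad(z\in\mathbb{D}),$$ where both quotients take the value $1$ at the removable singularity $z=0$. For $0\le\alpha<1$, $\mathcal{S}^*(\alpha)$ is the class of univalent $f\in\mathcal{A}$ with $\operatorname{Re}s_f>\alpha$ on $\mathbb{D}$. For a function $\varphi$ on $\mathbb{D}$, $\mathcal{S}^*(\varphi)$ is the class of all $f\in\mathcal{A}$ with no zero in $\mathbb{D}\setminus\{0\}$ and $s_f\prec\varphi$, that is, $s_f=\varphi\circ\omega$ for some analytic $\omega:\mathbb{D}\to\mathbb{D}$ with $\omega(0)=0$. Let $\mathcal{S}^*_L,\mathcal{S}^*_P,\mathcal{S}^*_e,\mathcal{S}^*_{\sin},\mathcal{S}^*_{☾},\mathcal{S}^*_R,\mathcal{S}^*_C$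 be the classes $\mathcal{S}^*(\varphi)$ for $\varphi(z)$ equal, respectively, to $$\sqrt{1+z},\quad 1+\frac{2}{\pi^2}\Bigl(\log\frac{1+\sqrt z}{1-\sqrt z}\Bigr)^2,\quad e^z,\quad 1+\sin z,\quad z+\sqrt{1+z^2},\quad 1+\frac{kz+z^2}{k^2-kz}\ (k=\sqrt2+1),\quad 1+\frac43z+\frac23z^2$$ (principal branches). For classes $\mathcal{F},\mathcal{G}$ of functions in $\mathcal{A}$, the $\mathcal{G}$-radius $R_{\mathcal{G}}(\mathcal{F})$ is the largest $R\in[0,1]$ such that for all $f\in\mathcal{F}$ and all $0<r<R$ the function $f$ has the property of $\mathcal{G}$ in the disk $|z|<r$, i.e. $z\mapsto f(rz)/r$ belongs to $\mathcal{G}$. Write $R_{\mathcal{G}}=R_{\mathcal{G}}(\mathcal{F}_1)$. Then: (i) for every $0\le\alpha<1$, $R_{\mathcal{S}^*(\alpha)}$ is the smallest positive root of $(\alpha-2)r^3-(2\alpha+2)r^2+(10-\alpha)r+2\alpha-2=0$; (ii) $R_{\mathcal{S}^*_L}\approx0.0918$ is the smallest positive root of $(2-\sqrt2)r^3-(2+2\sqrt2)r^2+(\sqrt2-10)r+2\sqrt2-2=0$;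 (iii) $R_{\mathcal{S}^*_P}=R_{\mathcal{S}^*(1/2)}\approx0.1092$; (iv) $R_{\mathcal{S}^*_e}=R_{\mathcal{S}^*(1/e)}\approx0.1370$; (v) $R_{\mathcal{S}^*_{\sin}}=R_{\mathcal{S}^*(1-\sin1)}\approx0.17969$; (vi) $R_{\mathcal{S}^*_{☾}}=R_{\mathcal{S}^*(\sqrt2-1)}\approx0.12734$; (vii) $R_{\mathcal{S}^*_R}=R_{\mathcal{S}^*(2(\sqrt2-1))}\approx0.0380$; (viii) $R_{\mathcal{S}^*_C}=R_{\mathcal{S}^*(1/3)}\approx0.14418$. Here $\approx$ means an error of less than one unit in the last digit given. The function $$f_1(z)=\frac{(1+z)^2(z+z^2/2)}{(1-z)^2}$$ belongs to $\mathcal{F}_1$ and is extremal in all cases: $R_{\mathcal{G}}(\{f_1\})=R_{\mathcal{G}}(\mathcal{F}_1)$ for each of the classes $\mathcal{G}$ above. -/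

import Mathlib

open Complex Metric Set

noncomputable section

namespace CloseToStar

/-- The open unit disk. -/
def disk : Set ℂ := ball (0 : ℂ) 1

/-- The class of normalized analytic functions on the unit disk. A function on the disk is
represented by a function on `ℂ`; no class below looks at its values off the disk. -/
def classA : Set (ℂ → ℂ) :=
  {f | AnalyticOnNhd ℂ f disk ∧ f 0 = 0 ∧ deriv f 0 = 1}

/-- The normalized univalent functions. -/
def classS : Set (ℂ → ℂ) :=
  {f | f ∈ classA ∧ InjOn f disk}

/-- `s_f(z) = z f'(z) / f(z)`, with the removable singularity of a normalized `f` at the origin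
filled in by the value `1`. -/
def starQuot (f : ℂ → ℂ) (z : ℂ) : ℂ :=
  if z = 0 then 1 else z * deriv f z / f z

/-- The normalized univalent functions that are starlike of order `α`. -/
def starlikeOfOrder (α : ℝ) : Set (ℂ → ℂ) :=
  {f | f ∈ classS ∧ ∀ z ∈ disk, α < (starQuot f z).re}

/-- Subordination `f ≺ g` on the unit disk. -/
def Subordinate (f g : ℂ → ℂ) : Prop :=
  ∃ ω : ℂ → ℂ, AnalyticOnNhd ℂ ω disk ∧ MapsTo ω disk disk ∧ ω 0 = 0 ∧
    ∀ z ∈ disk, f z = g (ω z)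

/-- The class of all normalized analytic `f` for which `s_f` is defined on the disk (so `f` has no
zero besides the origin) and `s_f ≺ φ`. -/
def starlikeSub (φ : ℂ → ℂ) : Set (ℂ → ℂ) :=
  {f | f ∈ classA ∧ (∀ z ∈ disk, z ≠ 0 → f z ≠ 0) ∧ Subordinate (starQuot f) φ}

/-- `√(1 + z)`, principal branch (lemniscate). -/
def phiL (z : ℂ) : ℂ := (1 + z) ^ (1 / 2 : ℂ)

/-- `e ^ z` (exponential). -/
def phiE (z : ℂ) : ℂ := Complex.exp z

/-- `1 + (4/3) z + (2/3) z ^ 2` (cardioid). -/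
def phiC (z : ℂ) : ℂ := 1 + (4 / 3) * z + (2 / 3) * z ^ 2

/-- `1 + sin z` (sine). -/
def phiSin (z : ℂ) : ℂ := 1 + Complex.sin z

/-- `z + √(1 + z ^ 2)`, principal branch (lune). -/
def phiLune (z : ℂ) : ℂ := z + (1 + z ^ 2) ^ (1 / 2 : ℂ)

/-- The constant `k = √2 + 1`. -/
def kR : ℂ := ((Real.sqrt 2 + 1 : ℝ) : ℂ)

/-- `1 + (z k + z ^ 2) / (k ^ 2 - k z)` with `k = √2 + 1` (rational function). -/
def phiR (z : ℂ) : ℂ := 1 + (z * kR + z ^ 2) / (kR ^ 2 - kR * z)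

/-- `1 + (2 / π ^ 2) (log ((1 + √z) / (1 - √z))) ^ 2`, principal branches (parabolic). -/
def phiP (z : ℂ) : ℂ :=
  1 + 2 / (Real.pi : ℂ) ^ 2 *
    (Complex.log ((1 + z ^ (1 / 2 : ℂ)) / (1 - z ^ (1 / 2 : ℂ)))) ^ 2

/-- The class `F₁`. The two quotients have removable singularities at the origin, where both are
filled in by the value `1`; hence the inequalities are required off the origin. At a zero of a
denominator off the origin the inequality fails, since the quotient there is `0` in Lean. -/
def classF1 : Set (ℂ → ℂ) :=
  {f | f ∈ classA ∧ ∃ g ∈ classA, ∀ z ∈ disk, z ≠ 0 →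
    0 < (f z / g z).re ∧ 0 < (g z / (z + z ^ 2 / 2)).re}

/-- The function `f₁(z) = (1 + z)² (z + z²/2) / (1 - z)²`. -/
def extremal (z : ℂ) : ℂ := (1 + z) ^ 2 * (z + z ^ 2 / 2) / (1 - z) ^ 2

/-- The restriction of `f` to the disk of radius `r`, rescaled to the unit disk:
`z ↦ f(r z) / r`. Having the property of a class in the disk of radius `r` means that this
function belongs to the class. -/
def dilate (r : ℝ) (f : ℂ → ℂ) (z : ℂ) : ℂ := f (r * z) / r

/-- The numbers `R` in `[0, 1]` such that every function in `F` has the property of the class `G`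
in each disk of radius `r`, `0 < r < R`. -/
def admissibleRadii (G F : Set (ℂ → ℂ)) : Set ℝ :=
  {R | 0 ≤ R ∧ R ≤ 1 ∧ ∀ f ∈ F, ∀ r : ℝ, 0 < r → r < R → dilate r f ∈ G}

/-- The `G`-radius of `F`: the largest admissible radius. -/
def radius (G F : Set (ℂ → ℂ)) : ℝ := sSup (admissibleRadii G F)

/-- The supremum in the definition of the radius is always attained. -/
theorem radius_isGreatest (G F : Set (ℂ → ℂ)) :
    IsGreatest (admissibleRadii G F) (radius G F) := by
  have h0 : (0 : ℝ) ∈ admissibleRadii G F :=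
    ⟨le_rfl, zero_le_one, fun f _ r h1 h2 => absurd h1 (not_lt.2 h2.le)⟩
  have hb : BddAbove (admissibleRadii G F) := ⟨1, fun R hR => hR.2.1⟩
  refine ⟨⟨le_csSup hb h0, csSup_le ⟨0, h0⟩ fun R hR => hR.2.1, ?_⟩, fun R hR => le_csSup hb hR⟩
  intro f hf r hr hlt
  obtain ⟨R, hR, hrR⟩ := exists_lt_of_lt_csSup ⟨0, h0⟩ hlt
  exact hR.2.2 f hf r hr hrR

end CloseToStar

end

open CloseToStar

namespace CloseToStar

open Filter Topology ComplexConjugate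

/-! With `p = f/g` and `q = g/(z + z²/2)`, a member of `F₁` is `f = z·p·q·(1 + z/2)` where `p`, `q`
have positive real part, so `s_f = 1 + z/(2+z) + zp'/p + zq'/q`. Schwarz–Pick bounds each of the
last two terms by `2t/(1-t²)`, `t = |z|`, hence `|s_f - 1| ≤ 1 - lowerBound t`
(`norm_starQuot_sub_one_le`). For `f₁` both factors are the Cayley transform and `s_f(-t)` equals
`lowerBound t` (`starQuot_extremal_neg`). As `lowerBound` decreases strictly and `starPoly α` is `α
- lowerBound` times a positive factor, the critical radius is where `lowerBound = α`.

For `S*(α)`, univalence comes from `log f` in the coordinate `log z`. For each `S*(φ)` other than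
the lemniscate class, `α = φ(-1)`: an analytic right inverse of `φ` on `|w - 1| < 1 - α`, with
values in the unit disk, gives the subordination below the radius, and omission of `(0, α)` by `φ`
excludes `f₁` beyond it (`radius_starlikeSub`).

For the lemniscate the obstruction is `√2 = φ(1)`, at the other end. There `s_f` is enclosed in a
disk whose centre depends on `t` and whose rightmost point is `upperBound t`, the value of `s_f` at
`t` for `f₁`; such disks lie inside the lemniscate while `upperBound t < √2`. -/

theorem isOpen_disk : IsOpen disk := isOpen_ball

theorem mem_disk {z : ℂ} : z ∈ disk ↔ ‖z‖ < 1 := by simp [disk]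

theorem zero_mem_disk : (0 : ℂ) ∈ disk := by simp [disk]

/-! ### Schwarz–Pick in the right half-plane -/

/-- The Schwarz-Pick inequality for functions with values in the right half-plane. -/
theorem norm_deriv_mul_le_of_re_pos {p : ℂ → ℂ} (hp : DifferentiableOn ℂ p disk)
    (hre : ∀ z ∈ disk, 0 < (p z).re) {z : ℂ} (hz : z ∈ disk) :
    ‖deriv p z‖ * (1 - ‖z‖ ^ 2) ≤ 2 * (p z).re := by
  have hz1 : ‖z‖ < 1 := mem_disk.1 hz
  have hsq : ‖z‖ ^ 2 < 1 := by nlinarith [norm_nonneg z]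
  set a := p z with ha
  have ha0 : 0 < a.re := hre z hz
  -- The disk automorphism taking `0` to `z`; it moves the estimate to the origin.
  set T : ℂ → ℂ := fun ζ => (ζ + z) / (1 + conj z * ζ) with hT
  have hden : ∀ ζ ∈ disk, 1 + conj z * ζ ≠ 0 := by
    intro ζ hζ h0
    have h1 : ‖conj z * ζ‖ = 1 := by
      rw [show conj z * ζ = -1 by linear_combination h0]; simp
    rw [norm_mul, RCLike.norm_conj] at h1
    nlinarith [mem_disk.1 hζ, norm_nonneg z, norm_nonneg ζ]
  have hTmaps : ∀ ζ ∈ disk, T ζ ∈ disk := by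
    intro ζ hζ
    rw [mem_disk, show T ζ = (ζ + z) / (1 + conj z * ζ) from rfl, norm_div, div_lt_one (norm_pos_iff.2 (hden ζ hζ))]
    apply lt_of_pow_lt_pow_left₀ 2 (norm_nonneg _)
    have hζ1 : ‖ζ‖ ^ 2 < 1 := by nlinarith [mem_disk.1 hζ, norm_nonneg ζ]
    rw [Complex.sq_norm, Complex.normSq_apply] at hζ1 hsq
    rw [Complex.sq_norm, Complex.normSq_apply, Complex.sq_norm, Complex.normSq_apply]
    simp only [add_re, add_im, mul_re, mul_im, conj_re, conj_im, one_re, one_im]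
    -- `|1 + z̄ζ|² - |ζ + z|² = (1 - |ζ|²)(1 - |z|²)`.
    nlinarith [mul_pos (sub_pos.2 hζ1) (sub_pos.2 hsq)]
  have hTd : ∀ ζ ∈ disk, DifferentiableAt ℂ T ζ := fun ζ hζ =>
    DifferentiableAt.div (by fun_prop) (by fun_prop) (hden ζ hζ)
  have hT0 : T 0 = z := by simp [hT]
  have hTderiv : HasDerivAt T (1 - (‖z‖ : ℂ) ^ 2) 0 := by
    have h1 : HasDerivAt (fun ζ : ℂ => ζ + z) 1 0 := (hasDerivAt_id _).add_const _
    have h2 : HasDerivAt (fun ζ : ℂ => 1 + conj z * ζ) (conj z) 0 := by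
      simpa using ((hasDerivAt_id (0 : ℂ)).const_mul (conj z)).const_add 1
    refine HasDerivAt.congr_deriv (f := T) (h1.div h2 (by simp)) ?_
    simp only [mul_zero, add_zero, zero_add, one_pow, div_one, mul_one]
    rw [Complex.mul_conj']
  have hpz : HasDerivAt p (deriv p z) (T 0) := by
    rw [hT0]
    exact (hp.differentiableAt (isOpen_disk.mem_nhds hz)).hasDerivAt
  have hq : HasDerivAt (fun ζ => p (T ζ)) (deriv p z * (1 - (‖z‖ : ℂ) ^ 2)) 0 :=
    hpz.comp 0 hTderiv
  -- The Möbius map `w ↦ (w - a)/(w + ā)` sends the right half-plane to the disk and `a` to `0`, so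
  -- the Schwarz lemma bounds `|h'(0)|` by `1`.
  set h : ℂ → ℂ := fun ζ => (p (T ζ) - a) / (p (T ζ) + conj a) with hh
  have hne : ∀ w : ℂ, 0 < w.re → w + conj a ≠ 0 := by
    intro w hw h0
    have := congrArg Complex.re h0
    simp at this
    linarith
  have haa : a + conj a = ((2 * a.re : ℝ) : ℂ) := Complex.add_conj a
  have hderiv : HasDerivAt h (deriv p z * (1 - (‖z‖ : ℂ) ^ 2) / ((2 * a.re : ℝ) : ℂ)) 0 := by
    have h3 := (hq.sub_const a).div (hq.add_const (conj a)) (by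
      rw [hT0]; exact hne _ ha0)
    refine HasDerivAt.congr_deriv (f := h) h3 ?_
    rw [hT0, ← ha, haa]
    have : ((2 * a.re : ℝ) : ℂ) ≠ 0 := by
      exact_mod_cast (by positivity : (2 * a.re) ≠ 0)
    field_simp
    ring
  have hmaps : MapsTo h (ball 0 1) (closedBall (h 0) 1) := by
    intro ζ hζ
    have h0 : h 0 = 0 := by simp [hh, hT0, ← ha]
    have hre' := hre _ (hTmaps ζ hζ)
    rw [h0, mem_closedBall, dist_zero_right,
      show h ζ = (p (T ζ) - a) / (p (T ζ) + conj a) from rfl, norm_div, div_le_one (norm_pos_iff.2 (hne _ hre'))]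
    apply le_of_sq_le_sq _ (norm_nonneg _)
    rw [Complex.sq_norm, Complex.normSq_apply, Complex.sq_norm, Complex.normSq_apply]
    simp
    nlinarith [mul_pos hre' ha0]
  have hdiff : DifferentiableOn ℂ h (ball 0 1) := by
    intro ζ hζ
    have hc : DifferentiableAt ℂ (fun ζ => p (T ζ)) ζ :=
      DifferentiableAt.comp ζ
        (hp.differentiableAt (isOpen_disk.mem_nhds (hTmaps ζ hζ))) (hTd ζ hζ)
    exact ((hc.sub_const a).div (hc.add_const _)
      (hne _ (hre _ (hTmaps ζ hζ)))).differentiableWithinAt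
  have key := Complex.norm_deriv_le_div_of_mapsTo_ball hdiff hmaps one_pos
  rw [hderiv.deriv, norm_div, norm_mul, div_one, Complex.norm_real, Real.norm_eq_abs,
    abs_of_pos (by positivity), div_le_one (by positivity)] at key
  have : ‖(1 - (‖z‖ : ℂ) ^ 2)‖ = 1 - ‖z‖ ^ 2 := by
    rw [show (1 - (‖z‖ : ℂ) ^ 2) = ((1 - ‖z‖ ^ 2 : ℝ) : ℂ) by push_cast; ring,
      Complex.norm_real, Real.norm_eq_abs, abs_of_pos (by linarith)]
  rwa [this] at key

/-- Replacing `Re p` by `|p|` loses nothing where `p` is real, as the Cayley transform is on the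
real axis; the bound stays sharp. -/
theorem norm_mul_deriv_div_le_of_re_pos {p : ℂ → ℂ} (hp : DifferentiableOn ℂ p disk)
    (hre : ∀ z ∈ disk, 0 < (p z).re) {z : ℂ} (hz : z ∈ disk) :
    ‖z * deriv p z / p z‖ ≤ 2 * ‖z‖ / (1 - ‖z‖ ^ 2) := by
  have hz1 : ‖z‖ < 1 := mem_disk.1 hz
  have hsq : 0 < 1 - ‖z‖ ^ 2 := by nlinarith [norm_nonneg z]
  have h1 := norm_deriv_mul_le_of_re_pos hp hre hz
  have h2 : (p z).re ≤ ‖p z‖ := Complex.re_le_norm _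
  have h3 : 0 < ‖p z‖ := (hre z hz).trans_le h2
  rw [norm_div, norm_mul, div_le_div_iff₀ h3 hsq]
  nlinarith [norm_nonneg z]

/-! ### Factorization of `F₁` and bounds for `s_f` -/

/-- A pair of functions with positive real part whose product with `z + z ^ 2 / 2` is `f`. -/
structure Factorization (f p q : ℂ → ℂ) : Prop where
  diff_left : DifferentiableOn ℂ p disk
  diff_right : DifferentiableOn ℂ q disk
  re_left : ∀ z ∈ disk, 0 < (p z).re
  re_right : ∀ z ∈ disk, 0 < (q z).re
  eq_mul : ∀ z ∈ disk, f z = z * (p z * q z * (1 + z / 2))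

/-- `dslope f 0` is `f(z)/z` with the removable singularity filled in. -/
theorem dslope_zero_eq {f : ℂ → ℂ} (hf : f ∈ classA) :
    DifferentiableOn ℂ (dslope f 0) disk ∧ dslope f 0 0 = 1 ∧
      ∀ z, f z = z * dslope f 0 z := by
  obtain ⟨h1, h2, h3⟩ := hf
  refine ⟨(differentiableOn_dslope (isOpen_disk.mem_nhds zero_mem_disk)).2
    h1.differentiableOn, by rw [dslope_same, h3], fun z => ?_⟩
  have := sub_smul_dslope f 0 z
  simp only [sub_zero, h2, smul_eq_mul] at this
  exact this.symm

theorem exists_factorization {f : ℂ → ℂ} (hf : f ∈ classF1) :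
    ∃ p q, Factorization f p q := by
  obtain ⟨hA, g, hg, h⟩ := hf
  obtain ⟨hFd, hF0, hF⟩ := dslope_zero_eq hA
  obtain ⟨hGd, hG0, hG⟩ := dslope_zero_eq hg
  set F := dslope f 0
  set G := dslope g 0
  have hlin : ∀ z ∈ disk, (1 + z / 2 : ℂ) ≠ 0 := by
    intro z hz h0
    have h1 : z = -2 := by linear_combination 2 * h0
    have := mem_disk.1 hz
    rw [h1] at this
    norm_num at this
  -- At a zero of `g` off the origin the quotient `f/g` is `0` in Lean, which contradicts
  -- positivity.
  have hGne : ∀ z ∈ disk, G z ≠ 0 := by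
    intro z hz h0
    by_cases hz0 : z = 0
    · rw [hz0, hG0] at h0; exact one_ne_zero h0
    · have := (h z hz hz0).1
      rw [hG z, h0] at this
      simp at this
  refine ⟨fun z => F z / G z, fun z => G z / (1 + z / 2), hFd.div hGd hGne,
    hGd.div (by fun_prop) hlin, fun z hz => ?_, fun z hz => ?_, fun z hz => ?_⟩
  · by_cases hz0 : z = 0
    · rw [hz0, hF0, hG0]; simp
    · have := (h z hz hz0).1
      rwa [hF z, hG z, mul_div_mul_left _ _ hz0] at this
  · by_cases hz0 : z = 0
    · rw [hz0, hG0]; simp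
    · have := (h z hz hz0).2
      rwa [hG z, show z + z ^ 2 / 2 = z * (1 + z / 2) by ring, mul_div_mul_left _ _ hz0] at this
  · have h1 := hGne z hz
    have h2 := hlin z hz
    rw [hF z]
    have h3 : (2 + z) ≠ 0 := fun h3 => h2 (by linear_combination h3 / 2)
    field_simp

namespace Factorization

variable {f p q : ℂ → ℂ}

theorem left_ne_zero (h : Factorization f p q) {z : ℂ} (hz : z ∈ disk) : p z ≠ 0 := fun h0 => by
  simpa [h0] using h.re_left z hz

theorem right_ne_zero (h : Factorization f p q) {z : ℂ} (hz : z ∈ disk) : q z ≠ 0 := fun h0 => by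
  simpa [h0] using h.re_right z hz

theorem re_two_add_pos {z : ℂ} (hz : z ∈ disk) : 0 < (2 + z).re := by
  have h1 := (abs_le.1 (Complex.abs_re_le_norm z)).1
  have := mem_disk.1 hz
  simp
  linarith

theorem two_add_ne_zero {z : ℂ} (hz : z ∈ disk) : 2 + z ≠ 0 := fun h0 => by
  simpa [h0] using re_two_add_pos hz

theorem ne_zero (h : Factorization f p q) {z : ℂ} (hz : z ∈ disk) (hz0 : z ≠ 0) : f z ≠ 0 := by
  rw [h.eq_mul z hz]
  have h1 : (1 + z / 2) ≠ 0 := by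
    rw [show 1 + z / 2 = (2 + z) / 2 by ring]
    exact div_ne_zero (two_add_ne_zero hz) two_ne_zero
  exact mul_ne_zero hz0 (mul_ne_zero (mul_ne_zero (h.left_ne_zero hz) (h.right_ne_zero hz)) h1)

theorem hasDerivAt_left (h : Factorization f p q) {z : ℂ} (hz : z ∈ disk) :
    HasDerivAt p (deriv p z) z :=
  (h.diff_left.differentiableAt (isOpen_disk.mem_nhds hz)).hasDerivAt

theorem hasDerivAt_right (h : Factorization f p q) {z : ℂ} (hz : z ∈ disk) :
    HasDerivAt q (deriv q z) z :=
  (h.diff_right.differentiableAt (isOpen_disk.mem_nhds hz)).hasDerivAt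

theorem starQuot_eq (h : Factorization f p q) {z : ℂ} (hz : z ∈ disk) :
    starQuot f z = 1 + z / (2 + z) + z * deriv p z / p z + z * deriv q z / q z := by
  by_cases hz0 : z = 0
  · simp [starQuot, hz0]
  have hd := (hasDerivAt_id z).mul (((h.hasDerivAt_left hz).mul (h.hasDerivAt_right hz)).mul
    (((hasDerivAt_id z).div_const 2).const_add 1))
  have he : f =ᶠ[𝓝 z] id * (p * q * fun z => 1 + id z / 2) := by
    filter_upwards [isOpen_disk.mem_nhds hz] with w hw using h.eq_mul w hw
  rw [starQuot, if_neg hz0, (hd.congr_of_eventuallyEq he).deriv, h.eq_mul z hz]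
  have h1 := h.left_ne_zero hz
  have h2 := h.right_ne_zero hz
  have h3 := two_add_ne_zero hz
  have h4 : (1 + z / 2) ≠ 0 := by
    rw [show 1 + z / 2 = (2 + z) / 2 by ring]
    exact div_ne_zero h3 two_ne_zero
  simp only [id, Pi.mul_apply]
  field_simp
  ring

theorem differentiableOn_starQuot (h : Factorization f p q) :
    DifferentiableOn ℂ (starQuot f) disk := by
  have hp' := h.diff_left.deriv isOpen_disk
  have hq' := h.diff_right.deriv isOpen_disk
  have : DifferentiableOn ℂ
      (fun z => 1 + z / (2 + z) + z * deriv p z / p z + z * deriv q z / q z) disk :=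
    (((differentiableOn_const 1).add (differentiableOn_id.div (by fun_prop)
      fun z hz => two_add_ne_zero hz)).add ((differentiableOn_id.mul hp').div h.diff_left
      fun z hz => h.left_ne_zero hz)).add ((differentiableOn_id.mul hq').div h.diff_right
      fun z hz => h.right_ne_zero hz)
  exact this.congr fun z hz => h.starQuot_eq hz

theorem norm_starQuot_sub_le (h : Factorization f p q) {z : ℂ} (hz : z ∈ disk) :
    ‖starQuot f z - (1 + z / (2 + z))‖ ≤ 4 * ‖z‖ / (1 - ‖z‖ ^ 2) := by
  rw [h.starQuot_eq hz]
  have h1 := norm_mul_deriv_div_le_of_re_pos h.diff_left h.re_left hz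
  have h2 := norm_mul_deriv_div_le_of_re_pos h.diff_right h.re_right hz
  calc _ = ‖z * deriv p z / p z + z * deriv q z / q z‖ := by congr 1; ring
    _ ≤ _ := norm_add_le _ _
    _ ≤ 2 * ‖z‖ / (1 - ‖z‖ ^ 2) + 2 * ‖z‖ / (1 - ‖z‖ ^ 2) := add_le_add h1 h2
    _ = _ := by ring

theorem norm_starQuot_sub_one_le (h : Factorization f p q) {z : ℂ} (hz : z ∈ disk) :
    ‖starQuot f z - 1‖ ≤ ‖z‖ / (2 - ‖z‖) + 4 * ‖z‖ / (1 - ‖z‖ ^ 2) := by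
  have h1 := h.norm_starQuot_sub_le hz
  have h2 : ‖z / (2 + z)‖ ≤ ‖z‖ / (2 - ‖z‖) := by
    rw [norm_div]
    have h3 : 2 - ‖z‖ ≤ ‖2 + z‖ := by
      have := norm_sub_norm_le (2 : ℂ) (-z)
      simpa using this
    have := mem_disk.1 hz
    exact div_le_div_of_nonneg_left (norm_nonneg z) (by linarith) h3
  calc _ = ‖z / (2 + z) + (starQuot f z - (1 + z / (2 + z)))‖ := by congr 1; ring
    _ ≤ _ := norm_add_le _ _
    _ ≤ _ := add_le_add h2 h1

end Factorization

/-! ### Univalence -/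

/-- Noshiro–Warschawski. If `F a = F b`, Rolle's theorem for `Re (F/(b - a))` along the segment
gives a zero of `Re F'`. -/
theorem injOn_of_re_deriv_pos {F F' : ℂ → ℂ} {U : Set ℂ} (hU : Convex ℝ U)
    (hF : ∀ z ∈ U, HasDerivAt F (F' z) z) (hre : ∀ z ∈ U, 0 < (F' z).re) : InjOn F U := by
  intro a ha b hb hab
  by_contra hne
  have hd : b - a ≠ 0 := sub_ne_zero.2 (Ne.symm hne)
  have hmem : ∀ t ∈ Icc (0 : ℝ) 1, a + (t : ℂ) * (b - a) ∈ U := fun t ht => by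
    have := hU.add_smul_sub_mem ha hb ht
    simpa using this
  set g : ℝ → ℝ := fun t => (F (a + (t : ℂ) * (b - a)) / (b - a)).re with hg
  have hgd : ∀ t ∈ Icc (0 : ℝ) 1, HasDerivAt g (F' (a + (t : ℂ) * (b - a))).re t := by
    intro t ht
    have h1 : HasDerivAt (fun w : ℂ => a + w * (b - a)) (b - a) (t : ℂ) := by
      simpa using ((hasDerivAt_id (t : ℂ)).mul_const (b - a)).const_add a
    have h2 := ((hF _ (hmem t ht)).comp (t : ℂ) h1).div_const (b - a)
    rw [mul_div_cancel_right₀ _ hd] at h2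
    exact h2.real_of_complex
  obtain ⟨c, hc, hc0⟩ := exists_hasDerivAt_eq_zero (f := g) zero_lt_one
    (fun t ht => (hgd t ht).continuousAt.continuousWithinAt) (by simp [hg, hab])
    (fun t ht => hgd t (Ioo_subset_Icc_self ht))
  exact (hre _ (hmem c (Ioo_subset_Icc_self hc))).ne' hc0

theorem Factorization.injOn_ball {f p q : ℂ → ℂ} (h : Factorization f p q) {ρ : ℝ}
    (hρ : ρ ≤ 1) (hre : ∀ z ∈ ball (0 : ℂ) ρ, 0 < (starQuot f z).re) :
    InjOn f (ball (0 : ℂ) ρ) := by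
  have hsub : ball (0 : ℂ) ρ ⊆ disk := ball_subset_ball hρ
  have hf0 : f 0 = 0 := by rw [h.eq_mul 0 zero_mem_disk, zero_mul]
  set U : Set ℂ := {w | Complex.exp w ∈ ball (0 : ℂ) ρ} with hU
  have hconv : Convex ℝ U := by
    rcases le_or_gt ρ 0 with h0 | h0
    · have : U = ∅ := by
        ext w; simp only [hU, mem_ofPred_eq, ball_eq_empty.2 h0, mem_empty_iff_false]
      rw [this]; exact convex_empty
    · have : U = {w | w.re < Real.log ρ} := by
        ext w
        simp [hU, Complex.norm_exp, Real.lt_log_iff_exp_lt h0]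
      rw [this]
      exact convex_halfSpace_re_lt _
  -- A branch of `log f(e^w)`: principal logarithms serve because each factor has positive real
  -- part. Its derivative is `s_f(e^w)`, and `U` is a half-plane or empty.
  set F : ℂ → ℂ := fun w => w + (Complex.log (p (Complex.exp w)) + Complex.log (q (Complex.exp w))
    + Complex.log ((2 + Complex.exp w) / 2)) with hF
  have hexpF : ∀ w ∈ U, Complex.exp (F w) = f (Complex.exp w) := by
    intro w hw
    have hz := hsub hw
    rw [h.eq_mul _ hz, hF]
    simp only [Complex.exp_add]
    rw [Complex.exp_log (h.left_ne_zero hz), Complex.exp_log (h.right_ne_zero hz),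
      Complex.exp_log (div_ne_zero (Factorization.two_add_ne_zero hz) two_ne_zero)]
    ring
  have hslit : ∀ {w : ℂ}, 0 < w.re → w ∈ slitPlane := fun hw => Or.inl hw
  have hFd : ∀ w ∈ U, HasDerivAt F (starQuot f (Complex.exp w)) w := by
    intro w hw
    have hz := hsub hw
    have he := Complex.hasDerivAt_exp w
    have h1 := ((h.hasDerivAt_left hz).comp w he).clog (hslit (h.re_left _ hz))
    have h2 := ((h.hasDerivAt_right hz).comp w he).clog (hslit (h.re_right _ hz))
    have h3 := ((he.const_add 2).div_const 2).clog (hslit (by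
      have := Factorization.re_two_add_pos hz
      simp only [Complex.div_ofNat_re]
      linarith))
    refine ((hasDerivAt_id w).add ((h1.add h2).add h3)).congr_deriv ?_
    rw [h.starQuot_eq hz]
    have h1 := h.left_ne_zero hz
    have h2 := h.right_ne_zero hz
    have h3 := Factorization.two_add_ne_zero hz
    simp only [Function.comp]
    field_simp
    ring
  have hinj := injOn_of_re_deriv_pos hconv hFd fun w hw => hre _ hw
  intro z₁ hz₁ z₂ hz₂ heq
  by_cases h1 : z₁ = 0
  · by_contra hne
    rw [h1, hf0] at heq
    exact h.ne_zero (hsub hz₂) (fun h2 => hne (h1.trans h2.symm)) heq.symm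
  by_cases h2 : z₂ = 0
  · rw [h2, hf0] at heq
    exact absurd heq (h.ne_zero (hsub hz₁) h1)
  have e1 : Complex.exp (Complex.log z₁) = z₁ := Complex.exp_log h1
  have e2 : Complex.exp (Complex.log z₂) = z₂ := Complex.exp_log h2
  have m1 : Complex.log z₁ ∈ U := by rw [hU, mem_ofPred_eq, e1]; exact hz₁
  have m2 : Complex.log z₂ ∈ U := by rw [hU, mem_ofPred_eq, e2]; exact hz₂
  have e3 : Complex.exp (F (Complex.log z₁)) = Complex.exp (F (Complex.log z₂)) := by
    rw [hexpF _ m1, hexpF _ m2, e1, e2, heq]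
  -- `F(w) - w` has period `2πi`, so the ambiguity `2πin` in the logarithm of `f` is absorbed by
  -- moving `log z₂` by the same amount.
  obtain ⟨n, hn⟩ := Complex.exp_eq_exp_iff_exists_int.1 e3
  have e4 : Complex.exp (Complex.log z₂ + n * (2 * Real.pi * I)) = z₂ := by
    rw [Complex.exp_eq_exp_iff_exists_int.2 ⟨n, rfl⟩, e2]
  have m3 : Complex.log z₂ + n * (2 * Real.pi * I) ∈ U := by
    rw [hU, mem_ofPred_eq, e4]; exact hz₂
  have e5 : F (Complex.log z₂ + n * (2 * Real.pi * I)) = F (Complex.log z₁) := by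
    rw [hn, hF]
    simp only [e4, e2]
    ring
  rw [← e1, ← e4, hinj m3 m1 e5]

/-! ### The polynomial `starPoly` and its root -/

/-- The sharp lower bound of `Re s_f` on the circle `|z| = t` over the class `F₁`. -/
noncomputable def lowerBound (t : ℝ) : ℝ := 1 - t / (2 - t) - 4 * t / (1 - t ^ 2)

/-- The polynomial whose smallest positive root is the radius of starlikeness of order `α`. -/
def starPoly (α r : ℝ) : ℝ :=
  (α - 2) * r ^ 3 - (2 * α + 2) * r ^ 2 + (10 - α) * r + 2 * α - 2

/-- On `[0, 1)` this turns signs and zeros of the cubic into comparisons of the monotone function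
`lowerBound` with `α`. -/
theorem starPoly_eq {α r : ℝ} (h0 : 0 ≤ r) (h1 : r < 1) :
    starPoly α r = (α - lowerBound r) * ((2 - r) * (1 - r ^ 2)) := by
  have h2 : 2 - r ≠ 0 := by linarith
  have h3 : 1 - r ^ 2 ≠ 0 := by nlinarith
  rw [starPoly, lowerBound]
  field_simp
  ring

theorem starPoly_factor_pos {r : ℝ} (h0 : 0 ≤ r) (h1 : r < 1) : 0 < (2 - r) * (1 - r ^ 2) :=
  mul_pos (by linarith) (by nlinarith)

theorem strictMonoOn_div_one_sub_sq : StrictMonoOn (fun t : ℝ => 4 * t / (1 - t ^ 2)) (Ico 0 1) := by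
  intro s hs t ht hst
  have h1 : 0 < 1 - s ^ 2 := by nlinarith [hs.1, hs.2]
  have h2 : 0 < 1 - t ^ 2 := by nlinarith [ht.1, ht.2]
  simp only
  rw [div_lt_div_iff₀ h1 h2]
  nlinarith [mul_nonneg hs.1 ht.1, hs.1, ht.1, mul_nonneg (mul_nonneg hs.1 ht.1) (sub_pos.2 hst).le]

theorem strictAntiOn_lowerBound : StrictAntiOn lowerBound (Ico 0 1) := by
  intro s hs t ht hst
  have h1 := strictMonoOn_div_one_sub_sq hs ht hst
  have h2 : s / (2 - s) ≤ t / (2 - t) := by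
    rw [div_le_div_iff₀ (by linarith [hs.2]) (by linarith [ht.2])]
    nlinarith
  simp only at h1
  rw [lowerBound, lowerBound]
  linarith

theorem lowerBound_of_root {α r : ℝ} (h0 : 0 ≤ r) (h1 : r < 1) (h : starPoly α r = 0) :
    lowerBound r = α := by
  rw [starPoly_eq h0 h1] at h
  have := (mul_eq_zero.1 h).resolve_right (starPoly_factor_pos h0 h1).ne'
  linarith

theorem exists_root_starPoly {α : ℝ} (h1 : α < 1) :
    ∃ R, 0 < R ∧ R < 1 ∧ starPoly α R = 0 := by
  have hc : ContinuousOn (starPoly α) (Icc 0 1) := by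
    unfold starPoly; fun_prop
  have := intermediate_value_Ioo zero_le_one hc
  obtain ⟨R, hR, h⟩ := this (show (0 : ℝ) ∈ _ from
    -- The values at `0` and `1` are `2α - 2 < 0` and `4`.
    ⟨by norm_num [starPoly]; linarith, by norm_num [starPoly]; linarith⟩)
  exact ⟨R, hR.1, hR.2, h⟩

theorem isLeast_root_starPoly {α R : ℝ} (h0 : 0 < R) (h1 : R < 1) (hR : starPoly α R = 0) :
    IsLeast {r : ℝ | 0 < r ∧ starPoly α r = 0} R := by
  refine ⟨⟨h0, hR⟩, fun s hs => ?_⟩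
  by_contra! hlt
  have h2 := strictAntiOn_lowerBound ⟨hs.1.le, hlt.trans h1⟩ ⟨h0.le, h1⟩ hlt
  rw [lowerBound_of_root h0.le h1 hR, lowerBound_of_root hs.1.le (hlt.trans h1) hs.2] at h2
  exact lt_irrefl _ h2

theorem abs_root_starPoly_sub_lt {α R c ε : ℝ} (h0 : 0 < R) (h1 : R < 1) (hR : starPoly α R = 0)
    (ha0 : 0 ≤ c - ε) (hb1 : c + ε < 1) (hε : 0 < ε)
    (ha : starPoly α (c - ε) < 0) (hb : 0 < starPoly α (c + ε)) : |R - c| < ε := by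
  have hv := lowerBound_of_root h0.le h1 hR
  rw [starPoly_eq ha0 (by linarith)] at ha
  rw [starPoly_eq (by linarith) hb1] at hb
  have ha' := neg_of_mul_neg_left ha (starPoly_factor_pos ha0 (by linarith)).le
  have hb' := pos_of_mul_pos_left hb (starPoly_factor_pos (by linarith) hb1).le
  have h2 := (strictAntiOn_lowerBound.lt_iff_gt ⟨h0.le, h1⟩ ⟨ha0, by linarith⟩).1
    (show lowerBound R < lowerBound (c - ε) by linarith)
  have h3 := (strictAntiOn_lowerBound.lt_iff_gt ⟨by linarith, hb1⟩ ⟨h0.le, h1⟩).1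
    (show lowerBound (c + ε) < lowerBound R by linarith)
  rw [abs_lt]
  constructor <;> linarith

/-! ### The extremal function -/

theorem one_sub_ne_zero_of_mem_disk {z : ℂ} (hz : z ∈ disk) : 1 - z ≠ 0 := fun h0 => by
  have := mem_disk.1 hz
  rw [show z = 1 by linear_combination -h0] at this
  simp at this

theorem re_cayley_pos {z : ℂ} (hz : z ∈ disk) : 0 < ((1 + z) / (1 - z)).re := by
  have hz' := mem_disk.1 hz
  have h1 : 0 < Complex.normSq (1 - z) := Complex.normSq_pos.2 (one_sub_ne_zero_of_mem_disk hz)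
  have h2 : ‖z‖ ^ 2 < 1 := by nlinarith [norm_nonneg z]
  rw [Complex.sq_norm, Complex.normSq_apply] at h2
  rw [Complex.div_re, ← add_div]
  apply div_pos _ h1
  simp
  nlinarith

theorem hasDerivAt_cayley {z : ℂ} (hz : z ∈ disk) :
    HasDerivAt (fun w : ℂ => (1 + w) / (1 - w)) (2 / (1 - z) ^ 2) z := by
  have h := one_sub_ne_zero_of_mem_disk hz
  refine (((hasDerivAt_id z).const_add 1).div ((hasDerivAt_id z).const_sub 1) h).congr_deriv ?_
  simp only [id]
  field_simp
  ring

theorem factorization_extremal :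
    Factorization extremal (fun z => (1 + z) / (1 - z)) (fun z => (1 + z) / (1 - z)) where
  diff_left z hz := (hasDerivAt_cayley hz).differentiableAt.differentiableWithinAt
  diff_right z hz := (hasDerivAt_cayley hz).differentiableAt.differentiableWithinAt
  re_left z hz := re_cayley_pos hz
  re_right z hz := re_cayley_pos hz
  eq_mul z hz := by
    have h := one_sub_ne_zero_of_mem_disk hz
    rw [extremal]
    field_simp

theorem mem_classA_of_eq_mul {f h : ℂ → ℂ} (hh : DifferentiableOn ℂ h disk) (h0 : h 0 = 1)
    (hf : ∀ z ∈ disk, f z = z * h z) : f ∈ classA := by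
  refine ⟨DifferentiableOn.analyticOnNhd ?_ isOpen_disk, by simp [hf 0 zero_mem_disk], ?_⟩
  · exact (differentiableOn_id.mul hh).congr hf
  · have h1 := (hasDerivAt_id (0 : ℂ)).mul
      (hh.differentiableAt (isOpen_disk.mem_nhds zero_mem_disk)).hasDerivAt
    have he : f =ᶠ[𝓝 0] id * h := by
      filter_upwards [isOpen_disk.mem_nhds zero_mem_disk] with w hw using hf w hw
    rw [(h1.congr_of_eventuallyEq he).deriv]
    simp [h0]

theorem extremal_mem_classA : extremal ∈ classA := by
  have h := factorization_extremal
  exact mem_classA_of_eq_mul ((h.diff_left.mul h.diff_right).mul (by fun_prop)) (by simp)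
    h.eq_mul

theorem extremal_mem_classF1 : extremal ∈ classF1 := by
  have h := factorization_extremal
  refine ⟨extremal_mem_classA, fun z => z * ((1 + z) / (1 - z) * (1 + z / 2)),
    mem_classA_of_eq_mul (h.diff_left.mul (by fun_prop)) (by simp) fun _ _ => rfl,
    fun z hz hz0 => ?_⟩
  have h1 : (1 + z) / (1 - z) ≠ 0 := h.left_ne_zero hz
  have h2 : (1 + z / 2) ≠ 0 := by
    rw [show 1 + z / 2 = (2 + z) / 2 by ring]
    exact div_ne_zero (Factorization.two_add_ne_zero hz) two_ne_zero
  have e1 : extremal z / (z * ((1 + z) / (1 - z) * (1 + z / 2))) = (1 + z) / (1 - z) := by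
    rw [h.eq_mul z hz, div_eq_iff (mul_ne_zero hz0 (mul_ne_zero h1 h2))]
    ring
  have e2 : z * ((1 + z) / (1 - z) * (1 + z / 2)) / (z + z ^ 2 / 2) = (1 + z) / (1 - z) := by
    rw [show z + z ^ 2 / 2 = z * (1 + z / 2) by ring, div_eq_iff (mul_ne_zero hz0 h2)]
    ring
  simp only [e1, e2]
  exact ⟨re_cayley_pos hz, re_cayley_pos hz⟩

theorem starQuot_extremal {x : ℝ} (hx : |x| < 1) :
    starQuot extremal x = ((1 + x / (2 + x) + 4 * x / (1 - x ^ 2) : ℝ) : ℂ) := by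
  have hz : (x : ℂ) ∈ disk := by rw [mem_disk, Complex.norm_real]; exact hx
  rw [factorization_extremal.starQuot_eq hz, (hasDerivAt_cayley hz).deriv]
  have h1 := one_sub_ne_zero_of_mem_disk hz
  have h2 := Factorization.two_add_ne_zero hz
  have h3 : (1 + x : ℂ) ≠ 0 := by
    have := one_sub_ne_zero_of_mem_disk (z := -x) (by simpa [mem_disk] using hx)
    simpa using this
  push_cast
  have h4 : (1 - x ^ 2 : ℂ) ≠ 0 := by
    rw [show (1 - x ^ 2 : ℂ) = (1 + x) * (1 - x) by ring]
    exact mul_ne_zero h3 h1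
  field_simp
  ring

/-- On the negative axis all terms of `s_f - 1` are nonpositive reals of the largest modulus
allowed, so the triangle inequality is an equality. -/
theorem starQuot_extremal_neg {t : ℝ} (h0 : 0 ≤ t) (h1 : t < 1) :
    starQuot extremal ((-t : ℝ) : ℂ) = (lowerBound t : ℝ) := by
  rw [starQuot_extremal (by rw [abs_neg, abs_of_nonneg h0]; exact h1), lowerBound]
  congr 1
  have h2 : 2 - t ≠ 0 := by linarith
  have h3 : 1 - t ^ 2 ≠ 0 := by nlinarith
  have h4 : (2 + -t) ≠ 0 := by linarith
  rw [neg_sq, ← sub_eq_add_neg 2 t]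
  ring

/-! ### Dilations and the two general radius criteria -/

theorem mul_mem_disk {r : ℝ} (h0 : 0 < r) (h1 : r ≤ 1) {z : ℂ} (hz : z ∈ disk) :
    (r : ℂ) * z ∈ disk := by
  rw [mem_disk, norm_mul, Complex.norm_real, Real.norm_eq_abs, abs_of_pos h0]
  nlinarith [mem_disk.1 hz, norm_nonneg z]

theorem norm_ofReal_mul {r : ℝ} (h0 : 0 < r) (z : ℂ) : ‖(r : ℂ) * z‖ = r * ‖z‖ := by
  rw [norm_mul, Complex.norm_real, Real.norm_eq_abs, abs_of_pos h0]

theorem deriv_dilate {f : ℂ → ℂ} {r : ℝ} (h0 : 0 < r) (z : ℂ) :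
    deriv (dilate r f) z = deriv f (r * z) := by
  have hr : (r : ℂ) ≠ 0 := by exact_mod_cast h0.ne'
  have : dilate r f = fun z => f (r * z) / r := rfl
  rw [this, deriv_div_const, deriv_comp_mul_left, smul_eq_mul, mul_div_cancel_left₀ _ hr]

theorem starQuot_dilate {f : ℂ → ℂ} {r : ℝ} (h0 : 0 < r) (z : ℂ) :
    starQuot (dilate r f) z = starQuot f (r * z) := by
  have hr : (r : ℂ) ≠ 0 := by exact_mod_cast h0.ne'
  by_cases hz : z = 0
  · simp [starQuot, hz]
  rw [starQuot, starQuot, if_neg hz, if_neg (mul_ne_zero hr hz), deriv_dilate h0, dilate,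
    div_div_eq_mul_div]
  ring

theorem dilate_mem_classA {f : ℂ → ℂ} (hf : f ∈ classA) {r : ℝ} (h0 : 0 < r) (h1 : r ≤ 1) :
    dilate r f ∈ classA := by
  refine ⟨DifferentiableOn.analyticOnNhd (fun z hz => ?_) isOpen_disk, by simp [dilate, hf.2.1],
    by rw [deriv_dilate h0, mul_zero, hf.2.2]⟩
  have h2 : DifferentiableAt ℂ f ((fun z : ℂ => (r : ℂ) * z) z) :=
    (hf.1 _ (mul_mem_disk h0 h1 hz)).differentiableAt
  exact ((h2.comp z (by fun_prop : DifferentiableAt ℂ (fun z : ℂ => (r : ℂ) * z) z)).div_const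
    (r : ℂ)).differentiableWithinAt

theorem radius_eq {G F : Set (ℂ → ℂ)} {R : ℝ} (h0 : 0 ≤ R) (h1 : R ≤ 1)
    (hin : ∀ f ∈ F, ∀ r : ℝ, 0 < r → r < R → dilate r f ∈ G)
    (hout : ∀ r : ℝ, R < r → r < 1 → ∃ f ∈ F, dilate r f ∉ G) : radius G F = R := by
  refine (radius_isGreatest G F).unique ⟨⟨h0, h1, hin⟩, fun S hS => ?_⟩
  by_contra! hlt
  obtain ⟨r, hr1, hr2⟩ := exists_between hlt
  obtain ⟨f, hf, hfr⟩ := hout r hr1 (hr2.trans_le hS.2.1)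
  exact hfr (hS.2.2 f hf r (h0.trans_lt hr1) hr2)

/-- Since `f₁` itself witnesses failure beyond `R`, the same two facts settle both radii. -/
theorem radius_classF1_eq {G : Set (ℂ → ℂ)} {R : ℝ} (h0 : 0 ≤ R) (h1 : R ≤ 1)
    (hin : ∀ f p q, f ∈ classA → Factorization f p q → ∀ r : ℝ, 0 < r → r < R → dilate r f ∈ G)
    (hout : ∀ r : ℝ, R < r → r < 1 → dilate r extremal ∉ G) :
    radius G classF1 = R ∧ radius G {extremal} = R := by
  have hin' : ∀ f ∈ classF1, ∀ r : ℝ, 0 < r → r < R → dilate r f ∈ G := fun f hf r hr hrR => by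
    obtain ⟨p, q, h⟩ := exists_factorization hf
    exact hin f p q hf.1 h r hr hrR
  refine ⟨radius_eq h0 h1 hin' fun r h2 h3 => ⟨_, extremal_mem_classF1, hout r h2 h3⟩,
    radius_eq h0 h1 ?_ fun r h2 h3 => ⟨_, rfl, hout r h2 h3⟩⟩
  rintro f rfl
  exact hin' _ extremal_mem_classF1

theorem norm_starQuot_sub_one_lt {f p q : ℂ → ℂ} (h : Factorization f p q) {α R : ℝ}
    (h0 : 0 < R) (h1 : R < 1) (hR : starPoly α R = 0) {z : ℂ} (hz : ‖z‖ < R) :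
    ‖starQuot f z - 1‖ < 1 - α := by
  have h2 := h.norm_starQuot_sub_one_le (mem_disk.2 (hz.trans h1))
  have h3 := strictAntiOn_lowerBound ⟨norm_nonneg z, hz.trans h1⟩ ⟨h0.le, h1⟩ hz
  rw [lowerBound_of_root h0.le h1 hR, lowerBound] at h3
  linarith

theorem lt_re_starQuot {f p q : ℂ → ℂ} (h : Factorization f p q) {α R : ℝ}
    (h0 : 0 < R) (h1 : R < 1) (hR : starPoly α R = 0) {z : ℂ} (hz : ‖z‖ < R) :
    α < (starQuot f z).re := by
  have h2 := norm_starQuot_sub_one_lt h h0 h1 hR hz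
  have h3 := (abs_le.1 (Complex.abs_re_le_norm (starQuot f z - 1))).1
  simp at h3
  linarith

/-- In each disk larger than that of radius `R`, `s_f` for the extremal function takes real values
just below its value at `-R`. -/
theorem exists_starQuot_dilate_extremal_eq {α R r ε : ℝ} (h0 : 0 < R)
    (hR : starPoly α R = 0) (hRr : R < r) (hr : r < 1) (hε : 0 < ε) :
    ∃ z ∈ disk, ∃ x : ℝ, α - ε < x ∧ x < α ∧ starQuot (dilate r extremal) z = x := by
  have hv := lowerBound_of_root h0.le (hRr.trans hr) hR
  have hc : ContinuousAt lowerBound R := by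
    unfold lowerBound
    have : 2 - R ≠ 0 := by linarith
    have : 1 - R ^ 2 ≠ 0 := by nlinarith
    fun_prop (disch := assumption)
  have h1 : ∀ᶠ t in 𝓝[>] R, α - ε < lowerBound t :=
    (hc.eventually (lt_mem_nhds (by linarith))).filter_mono nhdsWithin_le_nhds
  obtain ⟨t, ht, ht1, ht2⟩ := (h1.and (Ioo_mem_nhdsGT hRr)).exists
  have hr0 : 0 < r := h0.trans hRr
  have ht0 : 0 < t := h0.trans ht1
  have hrc : (r : ℂ) ≠ 0 := by exact_mod_cast hr0.ne'
  -- The dilation by `r` carries this point to `-t`, with `t` slightly larger than `R`.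
  refine ⟨((-t / r : ℝ) : ℂ), ?_, lowerBound t, ht, ?_, ?_⟩
  · rw [mem_disk, Complex.norm_real, Real.norm_eq_abs, abs_div, abs_neg, abs_of_pos ht0,
      abs_of_pos hr0, div_lt_one hr0]
    exact ht2
  · rw [← hv]
    exact strictAntiOn_lowerBound ⟨h0.le, hRr.trans hr⟩ ⟨ht0.le, ht2.trans hr⟩ ht1
  · rw [starQuot_dilate hr0, ← starQuot_extremal_neg ht0.le (ht2.trans hr)]
    congr 1
    push_cast
    field_simp

theorem radius_starlikeOfOrder {α R : ℝ} (hα : 0 ≤ α) (h0 : 0 < R) (h1 : R < 1)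
    (hR : starPoly α R = 0) :
    radius (starlikeOfOrder α) classF1 = R ∧ radius (starlikeOfOrder α) {extremal} = R := by
  refine radius_classF1_eq h0.le h1.le (fun f p q hf h r hr hrR => ?_) fun r hRr hr hmem => ?_
  · have hlt : ∀ z ∈ disk, ‖(r : ℂ) * z‖ < r := fun z hz => by
      rw [norm_ofReal_mul hr]
      nlinarith [mem_disk.1 hz]
    refine ⟨⟨dilate_mem_classA hf hr (hrR.trans h1).le, ?_⟩, fun z hz => ?_⟩
    · have hinj := h.injOn_ball (hrR.trans h1).le fun z hz => hα.trans_lt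
        (lt_re_starQuot h h0 h1 hR ((mem_ball_zero_iff.1 hz).trans hrR))
      have hrc : (r : ℂ) ≠ 0 := by exact_mod_cast hr.ne'
      intro z hz w hw hzw
      have h2 : f (r * z) = f (r * w) := by
        simpa [dilate, div_left_inj' hrc] using hzw
      exact mul_left_cancel₀ hrc (hinj (mem_ball_zero_iff.2 (hlt z hz))
        (mem_ball_zero_iff.2 (hlt w hw)) h2)
    · rw [starQuot_dilate hr]
      exact lt_re_starQuot h h0 h1 hR ((hlt z hz).trans hrR)
  · obtain ⟨z, hz, x, -, hx, he⟩ := exists_starQuot_dilate_extremal_eq h0 hR hRr hr one_pos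
    have := hmem.2 z hz
    rw [he, Complex.ofReal_re] at this
    linarith

/-- The Schwarz function is `ω(z) = ψ(s_f(rz))`; `ψ 1 = 0` gives `ω(0) = 0`. -/
theorem dilate_mem_starlikeSub {f p q φ ψ : ℂ → ℂ} {U : Set ℂ} (hf : f ∈ classA)
    (h : Factorization f p q) {r : ℝ} (h0 : 0 < r) (h1 : r ≤ 1)
    (hU : ∀ z : ℂ, ‖z‖ < r → starQuot f z ∈ U)
    (hψ : ∀ w ∈ U, DifferentiableAt ℂ ψ w) (hψ1 : ψ 1 = 0) (hψlt : ∀ w ∈ U, ‖ψ w‖ < 1)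
    (hφψ : ∀ w ∈ U, φ (ψ w) = w) : dilate r f ∈ starlikeSub φ := by
  have hrc : (r : ℂ) ≠ 0 := by exact_mod_cast h0.ne'
  have hlt : ∀ z ∈ disk, ‖(r : ℂ) * z‖ < r := fun z hz => by
    rw [norm_ofReal_mul h0]
    nlinarith [mem_disk.1 hz]
  refine ⟨dilate_mem_classA hf h0 h1, fun z hz hz0 => div_ne_zero
    (h.ne_zero (mul_mem_disk h0 h1 hz) (mul_ne_zero hrc hz0)) hrc,
    fun z => ψ (starQuot f (r * z)), DifferentiableOn.analyticOnNhd (fun z hz => ?_) isOpen_disk,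
    fun z hz => mem_disk.2 (hψlt _ (hU _ (hlt z hz))), by simp [starQuot, hψ1], fun z hz => ?_⟩
  · have hs : DifferentiableAt ℂ (starQuot f) ((fun z : ℂ => (r : ℂ) * z) z) :=
      h.differentiableOn_starQuot.differentiableAt
        (isOpen_disk.mem_nhds (mul_mem_disk h0 h1 hz))
    have hs' := hs.comp z (by fun_prop : DifferentiableAt ℂ (fun z : ℂ => (r : ℂ) * z) z)
    have hw : DifferentiableAt ℂ ψ (starQuot f (r * z)) := hψ _ (hU _ (hlt z hz))
    exact (DifferentiableAt.comp (g := ψ) z hw hs').differentiableWithinAt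
  · rw [starQuot_dilate h0, hφψ _ (hU _ (hlt z hz))]

theorem radius_starlikeSub {α R : ℝ} {φ : ℂ → ℂ} (ψ : ℂ → ℂ) (hα : 0 < α) (h0 : 0 < R)
    (h1 : R < 1) (hR : starPoly α R = 0)
    (hψ : ∀ w, ‖w - 1‖ < 1 - α → DifferentiableAt ℂ ψ w) (hψ1 : ψ 1 = 0)
    (hψlt : ∀ w, ‖w - 1‖ < 1 - α → ‖ψ w‖ < 1)
    (hφψ : ∀ w, ‖w - 1‖ < 1 - α → φ (ψ w) = w)
    (hφ : ∀ x : ℝ, 0 < x → x < α → ∀ z ∈ disk, φ z ≠ x) :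
    radius (starlikeSub φ) classF1 = R ∧ radius (starlikeSub φ) {extremal} = R := by
  refine radius_classF1_eq h0.le h1.le (fun f p q hf h r hr hrR => ?_) fun r hRr hr hmem => ?_
  · exact dilate_mem_starlikeSub (U := {w | ‖w - 1‖ < 1 - α}) hf h hr (hrR.trans h1).le
      (fun z hz => norm_starQuot_sub_one_lt h h0 h1 hR (hz.trans hrR)) hψ hψ1 hψlt hφψ
  -- Taking `ε = α` keeps `x` positive, so only omission of `(0, α)` is needed.
  · obtain ⟨z, hz, x, hx0, hx, he⟩ := exists_starQuot_dilate_extremal_eq h0 hR hRr hr hα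
    obtain ⟨ω, -, hω, -, hsub⟩ := hmem.2.2
    exact hφ x (by linarith) hx (ω z) (hω hz) ((hsub z hz).symm.trans he)

/-! ### The classes governed by `φ(-1)` -/

theorem cpow_half_sq (z : ℂ) : (z ^ (1 / 2 : ℂ)) ^ 2 = z := by
  rw [one_div]; exact Complex.cpow_ofNat_inv_pow z 2

theorem sq_cpow_half {z : ℂ} (hz : 0 < z.re) : (z ^ 2) ^ (1 / 2 : ℂ) = z := by
  rw [one_div]; exact Complex.sq_cpow_two_inv hz

theorem re_cpow_half_pos {z : ℂ} (hz : z ∈ slitPlane) : 0 < (z ^ (1 / 2 : ℂ)).re := by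
  rw [Complex.cpow_def_of_ne_zero (slitPlane_ne_zero hz), Complex.exp_re]
  have h1 : (Complex.log z * (1 / 2)).im = arg z / 2 := by
    simp [Complex.mul_im, Complex.log_im]; ring
  have h2 := Complex.neg_pi_lt_arg z
  have h3 := Complex.arg_le_pi z
  have h4 := Complex.mem_slitPlane_iff_arg.1 hz
  have h5 := lt_of_le_of_ne h3 h4.1
  rw [h1]
  exact mul_pos (Real.exp_pos _) (Real.cos_pos_of_mem_Ioo ⟨by linarith, by linarith⟩)

theorem norm_sub_one_lt_norm_add_one {s : ℂ} (hs : 0 < s.re) : ‖s - 1‖ < ‖s + 1‖ := by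
  apply lt_of_pow_lt_pow_left₀ 2 (norm_nonneg _)
  rw [Complex.sq_norm, Complex.normSq_apply, Complex.sq_norm, Complex.normSq_apply]
  simp
  nlinarith

theorem re_pos_of_norm_sub_one_lt {w : ℂ} {ρ : ℝ} (hρ : ρ ≤ 1) (h : ‖w - 1‖ < ρ) : 0 < w.re := by
  have h3 := (abs_le.1 (Complex.abs_re_le_norm (w - 1))).1
  simp at h3
  linarith

/-- The Taylor coefficients of `-log(1 - z)` are nonnegative, so `|z|` gives the majorant. -/
theorem norm_log_one_sub_le {z : ℂ} (hz : ‖z‖ < 1) :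
    ‖Complex.log (1 - z)‖ ≤ -Real.log (1 - ‖z‖) := by
  have h1 := (hasSum_nat_add_iff' 1).2 (Complex.hasSum_taylorSeries_neg_log hz)
  have h2 := Real.hasSum_pow_div_log_of_abs_lt_one (by rwa [abs_of_nonneg (norm_nonneg z)])
  rw [← norm_neg]
  simp only [Finset.range_one, Finset.sum_singleton, Nat.cast_zero, div_zero, sub_zero] at h1
  refine h1.norm_le_of_bounded h2 fun i => le_of_eq ?_
  rw [norm_div, norm_pow, Complex.norm_natCast]
  push_cast
  rfl

theorem radius_phiE {R : ℝ} (h0 : 0 < R) (h1 : R < 1) (hR : starPoly (1 / Real.exp 1) R = 0) :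
    radius (starlikeSub phiE) classF1 = R ∧ radius (starlikeSub phiE) {extremal} = R := by
  have he : 0 < 1 / Real.exp 1 := by positivity
  have hpos : ∀ w : ℂ, ‖w - 1‖ < 1 - 1 / Real.exp 1 → 0 < w.re := fun w hw =>
    re_pos_of_norm_sub_one_lt (by linarith) hw
  refine radius_starlikeSub Complex.log he h0 h1 hR
    (fun w hw => Complex.differentiableAt_log (Or.inl (hpos w hw))) Complex.log_one
    (fun w hw => ?_) (fun w hw => ?_) fun x hx hx1 z hz hzx => ?_
  · have h2 : ‖1 - w‖ < 1 - 1 / Real.exp 1 := by rwa [norm_sub_rev]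
    have h3 := norm_log_one_sub_le (z := 1 - w) (by linarith)
    rw [sub_sub_cancel] at h3
    refine h3.trans_lt ?_
    rw [neg_lt, Real.lt_log_iff_exp_lt (by linarith), Real.exp_neg, ← one_div]
    linarith
  · exact Complex.exp_log fun h => by simpa [h] using hpos w hw
  · have h2 := congrArg norm hzx
    rw [phiE, Complex.norm_exp, Complex.norm_real, Real.norm_eq_abs, abs_of_pos hx] at h2
    rw [← h2, one_div, ← Real.exp_neg, Real.exp_lt_exp] at hx1
    have h3 := (abs_le.1 (Complex.abs_re_le_norm z)).1
    have := mem_disk.1 hz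
    linarith

theorem radius_phiC {R : ℝ} (h0 : 0 < R) (h1 : R < 1) (hR : starPoly (1 / 3) R = 0) :
    radius (starlikeSub phiC) classF1 = R ∧ radius (starlikeSub phiC) {extremal} = R := by
  have hv : ∀ w : ℂ, ‖w - 1‖ < 1 - 1 / 3 → ‖3 / 2 * (w - 1)‖ < 1 := fun w hw => by
    rw [norm_mul]; norm_num at hw ⊢; linarith
  have hs : ∀ w : ℂ, ‖w - 1‖ < 1 - 1 / 3 → 1 + 3 / 2 * (w - 1) ∈ slitPlane := fun w hw =>
    Complex.mem_slitPlane_of_norm_lt_one (hv w hw)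
  -- Inverts `φ(z) = 1/3 + (2/3)(z + 1)²`, the completed square.
  refine radius_starlikeSub (fun w => (1 + 3 / 2 * (w - 1)) ^ (1 / 2 : ℂ) - 1) (by norm_num) h0 h1 hR
    (fun w hw => ?_) (by simp) (fun w hw => ?_) (fun w hw => ?_) fun x hx hx1 z hz hzx => ?_
  · have h2 : DifferentiableAt ℂ (fun w : ℂ => 1 + 3 / 2 * (w - 1)) w := by fun_prop
    exact (h2.cpow_const (hs w hw)).sub_const 1
  · have h2 := re_cpow_half_pos (hs w hw)
    have h3 := cpow_half_sq (1 + 3 / 2 * (w - 1))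
    set s := (1 + 3 / 2 * (w - 1)) ^ (1 / 2 : ℂ)
    have h4 : ‖s - 1‖ * ‖s + 1‖ < 1 := by
      rw [← norm_mul, show (s - 1) * (s + 1) = 3 / 2 * (w - 1) by linear_combination h3]
      exact hv w hw
    have h5 := norm_sub_one_lt_norm_add_one h2
    -- The product of `|s - 1|` and `|s + 1|` is below `1`, hence so is the smaller factor.
    nlinarith [norm_nonneg (s - 1)]
  · have h3 := cpow_half_sq (1 + 3 / 2 * (w - 1))
    rw [phiC]
    linear_combination 2 / 3 * h3
  · have hre := congrArg Complex.re hzx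
    have him := congrArg Complex.im hzx
    have h2 : phiC z = 1 / 3 + 2 / 3 * ((z + 1) * (z + 1)) := by rw [phiC]; ring
    rw [h2] at hre him
    simp at hre him
    have h3 := (abs_le.1 (Complex.abs_re_le_norm z)).1
    have h4 := mem_disk.1 hz
    have h5 : z.im = 0 := by
      rcases mul_eq_zero.1 (show (z.re + 1) * z.im = 0 by linarith) with h | h
      · linarith
      · exact h
    rw [h5] at hre
    nlinarith [mul_self_nonneg (z.re + 1)]

theorem normSq_sin (z : ℂ) :
    ‖Complex.sin z‖ ^ 2 = Real.sin z.re ^ 2 + Real.sinh z.im ^ 2 := by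
  rw [Complex.sin_eq, Complex.sq_norm, Complex.normSq_apply, ← Complex.ofReal_sin,
    ← Complex.ofReal_cos, ← Complex.ofReal_sinh, ← Complex.ofReal_cosh]
  simp only [← Complex.ofReal_mul, Complex.add_re, Complex.ofReal_re, Complex.add_im,
    Complex.ofReal_im, Complex.mul_I_re, Complex.mul_I_im]
  have h1 := Real.sin_sq_add_cos_sq z.re
  have h2 := Real.cosh_sq z.im
  linear_combination (Real.sinh z.im ^ 2) * h1 + (Real.sin z.re ^ 2) * h2

/-- Let `t = |Re z|`, `y = Im z`, and suppose `|z| ≥ 1`. If `t < 1`, then `sinh² y ≥ y² ≥ 1 - t² ≥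
sin(1-t) sin(1+t) = sin² 1 - sin² t`; if `t ≥ 1`, monotonicity of sine suffices. Either way `|sin z|
≥ sin 1`. -/
theorem norm_lt_one_of_norm_sin_lt {z : ℂ} (hz : |z.re| < Real.pi / 2)
    (h : ‖Complex.sin z‖ < Real.sin 1) : ‖z‖ < 1 := by
  have h1 : Real.sin z.re ^ 2 + Real.sinh z.im ^ 2 < Real.sin 1 ^ 2 := by
    rw [← normSq_sin]
    exact pow_lt_pow_left₀ h (norm_nonneg _) two_ne_zero
  by_contra! hn
  have h2 : 1 ≤ z.re ^ 2 + z.im ^ 2 := by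
    have := Complex.sq_norm z
    rw [Complex.normSq_apply] at this
    nlinarith
  have h3 : z.im ^ 2 ≤ Real.sinh z.im ^ 2 := by
    rw [sq_le_sq, Real.abs_sinh]
    exact Real.self_le_sinh_iff.2 (abs_nonneg _)
  have h4 : Real.sin z.re ^ 2 = Real.sin |z.re| ^ 2 := by
    rcases abs_cases z.re with h | h <;> simp [h.1]
  have h5 : z.re ^ 2 = |z.re| ^ 2 := (sq_abs _).symm
  rw [h4] at h1
  rw [h5] at h2
  have ht0 := abs_nonneg z.re
  generalize |z.re| = t at *
  have hs1 : 0 ≤ Real.sin 1 := Real.sin_nonneg_of_nonneg_of_le_pi zero_le_one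
    (by linarith [Real.pi_gt_three])
  rcases le_or_gt 1 t with ht | ht
  · have : Real.sin 1 ≤ Real.sin t := Real.sin_le_sin_of_le_of_le_pi_div_two
      (by linarith [Real.pi_gt_three]) hz.le ht
    nlinarith [sq_nonneg (Real.sinh z.im)]
  · have h6 : Real.sin 1 ^ 2 - Real.sin t ^ 2 = Real.sin (1 - t) * Real.sin (1 + t) := by
      rw [Real.sin_sub, Real.sin_add]
      linear_combination Real.sin 1 ^ 2 * (Real.sin_sq_add_cos_sq t).symm
        - Real.sin t ^ 2 * (Real.sin_sq_add_cos_sq 1).symm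
    have h7 := Real.sin_le (show 0 ≤ 1 - t by linarith)
    have h8 := Real.sin_le (show 0 ≤ 1 + t by linarith)
    have h9 : 0 ≤ Real.sin (1 + t) := Real.sin_nonneg_of_nonneg_of_le_pi (by linarith)
      (by linarith [Real.pi_gt_three])
    nlinarith

theorem one_sub_sq_mem_slitPlane {u : ℂ} (hu : ‖u‖ < 1) : 1 - u ^ 2 ∈ slitPlane := by
  rw [sub_eq_add_neg]
  apply Complex.mem_slitPlane_of_norm_lt_one
  rw [norm_neg, norm_pow]
  nlinarith [norm_nonneg u]

/-- `s + iu` and `s - iu` are reciprocal, so their real parts have the same sign, and these add up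
to `2 Re s > 0`. -/
theorem re_I_mul_add_cpow_half_pos {u : ℂ} (hu : ‖u‖ < 1) :
    0 < (I * u + (1 - u ^ 2) ^ (1 / 2 : ℂ)).re := by
  have h1 := re_cpow_half_pos (one_sub_sq_mem_slitPlane hu)
  have h2 := cpow_half_sq (1 - u ^ 2)
  set s := (1 - u ^ 2) ^ (1 / 2 : ℂ)
  have h3 : (I * u + s) * (s - I * u) = 1 := by
    linear_combination h2 - u ^ 2 * I_sq
  have h4 : s - I * u = (I * u + s)⁻¹ := eq_inv_of_mul_eq_one_right h3
  have h5 : (s - I * u).re = (I * u + s).re / Complex.normSq (I * u + s) := by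
    rw [h4, Complex.inv_re]
  by_contra! hn
  have h6 : (s - I * u).re ≤ 0 := by
    rw [h5]
    exact div_nonpos_of_nonpos_of_nonneg hn (Complex.normSq_nonneg _)
  simp only [Complex.sub_re, Complex.add_re] at hn h6
  linarith

theorem sin_neg_I_mul_log {u : ℂ} (hu : ‖u‖ < 1) :
    Complex.sin (-I * Complex.log (I * u + (1 - u ^ 2) ^ (1 / 2 : ℂ))) = u := by
  have h1 := re_I_mul_add_cpow_half_pos hu
  have h2 := cpow_half_sq (1 - u ^ 2)
  set s := (1 - u ^ 2) ^ (1 / 2 : ℂ)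
  have h0 : I * u + s ≠ 0 := fun h => by simp [h] at h1
  have h3 : (I * u + s) * (s - I * u) = 1 := by
    linear_combination h2 - u ^ 2 * I_sq
  rw [Complex.sin, show -(-I * Complex.log (I * u + s)) * I = -Complex.log (I * u + s) by
      linear_combination Complex.log (I * u + s) * I_sq,
    show -I * Complex.log (I * u + s) * I = Complex.log (I * u + s) by
      linear_combination -Complex.log (I * u + s) * I_sq,
    Complex.exp_neg, Complex.exp_log h0, ← eq_inv_of_mul_eq_one_right h3]
  linear_combination -u * I_sq

theorem radius_phiSin {R : ℝ} (h0 : 0 < R) (h1 : R < 1) (hR : starPoly (1 - Real.sin 1) R = 0) :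
    radius (starlikeSub phiSin) classF1 = R ∧ radius (starlikeSub phiSin) {extremal} = R := by
  have hs1 : Real.sin 1 < 1 := by
    have h := Real.sin_lt_sin_of_lt_of_le_pi_div_two (x := 1) (y := Real.pi / 2)
      (by linarith [Real.pi_gt_three]) le_rfl (by linarith [Real.pi_gt_three])
    rwa [Real.sin_pi_div_two] at h
  have hlt : ∀ w : ℂ, ‖w - 1‖ < 1 - (1 - Real.sin 1) → ‖w - 1‖ < 1 := fun w hw => by linarith
  refine radius_starlikeSub
    (fun w => -I * Complex.log (I * (w - 1) + (1 - (w - 1) ^ 2) ^ (1 / 2 : ℂ))) (by linarith)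
    h0 h1 hR (fun w hw => ?_) (by simp) (fun w hw => ?_) (fun w hw => ?_)
    fun x hx hx1 z hz hzx => ?_
  · have h2 : DifferentiableAt ℂ (fun w : ℂ => (1 - (w - 1) ^ 2) ^ (1 / 2 : ℂ)) w :=
      DifferentiableAt.cpow_const (by fun_prop) (one_sub_sq_mem_slitPlane (hlt w hw))
    have h3 : DifferentiableAt ℂ (fun w : ℂ => I * (w - 1)) w := by fun_prop
    exact ((h3.add h2).clog (Or.inl (re_I_mul_add_cpow_half_pos (hlt w hw)))).const_mul _
  · apply norm_lt_one_of_norm_sin_lt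
    · have := Complex.abs_arg_lt_pi_div_two_iff.2
        (Or.inl (re_I_mul_add_cpow_half_pos (hlt w hw)))
      simpa [Complex.log_im] using this
    · rw [sin_neg_I_mul_log (hlt w hw)]
      linarith
  · rw [phiSin, sin_neg_I_mul_log (hlt w hw)]
    ring
  · have h2 := (abs_le.1 (Complex.abs_re_le_norm z))
    have h3 := mem_disk.1 hz
    have h4 : Complex.sin z = ((x - 1 : ℝ) : ℂ) := by
      rw [phiSin] at hzx
      push_cast
      linear_combination hzx
    rw [Complex.sin_eq, ← Complex.ofReal_sin, ← Complex.ofReal_cos, ← Complex.ofReal_sinh,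
      ← Complex.ofReal_cosh] at h4
    simp only [← Complex.ofReal_mul] at h4
    have hre := congrArg Complex.re h4
    have him := congrArg Complex.im h4
    simp only [Complex.add_re, Complex.ofReal_re, Complex.add_im, Complex.ofReal_im,
      Complex.mul_I_re, Complex.mul_I_im] at hre him
    have hcos : 0 < Real.cos z.re := Real.cos_pos_of_mem_Ioo
      ⟨by linarith [Real.pi_gt_three], by linarith [Real.pi_gt_three]⟩
    have him0 : z.im = 0 := by
      rcases mul_eq_zero.1 (show Real.cos z.re * Real.sinh z.im = 0 by linarith) with h | h
      · exact absurd h hcos.ne'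
      · exact Real.sinh_eq_zero.1 h
    rw [him0] at hre
    have h5 : Real.sin (-1) < Real.sin z.re := Real.sin_lt_sin_of_lt_of_le_pi_div_two
      (by linarith [Real.pi_gt_three]) (by linarith [Real.pi_gt_three]) (by linarith)
    simp at hre h5
    linarith

theorem radius_phiLune {R : ℝ} (h0 : 0 < R) (h1 : R < 1) (hR : starPoly (Real.sqrt 2 - 1) R = 0) :
    radius (starlikeSub phiLune) classF1 = R ∧ radius (starlikeSub phiLune) {extremal} = R := by
  have hsq : Real.sqrt 2 ^ 2 = 2 := Real.sq_sqrt (by norm_num)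
  have hs1 : 1 < Real.sqrt 2 := by rw [Real.lt_sqrt] <;> norm_num
  have hpos : ∀ w : ℂ, ‖w - 1‖ < 1 - (Real.sqrt 2 - 1) → 0 < w.re := fun w hw =>
    re_pos_of_norm_sub_one_lt (by linarith) hw
  have hne : ∀ w : ℂ, ‖w - 1‖ < 1 - (Real.sqrt 2 - 1) → w ≠ 0 := fun w hw h => by
    simpa [h] using hpos w hw
  refine radius_starlikeSub (fun w => (w ^ 2 - 1) / (2 * w)) (by linarith) h0 h1 hR
    (fun w hw => DifferentiableAt.div (by fun_prop) (by fun_prop)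
      (mul_ne_zero two_ne_zero (hne w hw))) (by simp)
    (fun w hw => ?_) (fun w hw => ?_) fun x hx hx1 z hz hzx => ?_
  · have hn := norm_pos_iff.2 (mul_ne_zero two_ne_zero (hne w hw))
    rw [norm_div, div_lt_one hn]
    apply lt_of_pow_lt_pow_left₀ 2 (norm_nonneg _)
    have h2 : ‖w - 1‖ ^ 2 < 2 := by nlinarith [norm_nonneg (w - 1)]
    have h3 : 2 < ‖w + 1‖ ^ 2 := by
      have := norm_sub_norm_le (2 : ℂ) (1 - w)
      rw [show 2 - (1 - w) = w + 1 by ring, norm_sub_rev 1 w] at this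
      norm_num at this
      nlinarith
    -- This product equals `4|w|² - |w² - 1|²`: the lune is `|w - 1| < √2 < |w + 1|`.
    have h4 := mul_pos (sub_pos.2 h2) (sub_pos.2 h3)
    rw [Complex.sq_norm, Complex.normSq_apply, Complex.sq_norm, Complex.normSq_apply] at h4
    rw [Complex.sq_norm, Complex.normSq_apply, Complex.sq_norm, Complex.normSq_apply]
    simp [pow_two] at h4 ⊢
    nlinarith
  · have h2 := hne w hw
    -- Makes the principal root of `1 + z²` equal to `(w² + 1)/(2w)`.
    have h3 : 0 < ((w ^ 2 + 1) / (2 * w)).re := by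
      rw [show (w ^ 2 + 1) / (2 * w) = (w + w⁻¹) / 2 by field_simp]
      simp only [Complex.div_ofNat_re, Complex.add_re, Complex.inv_re]
      have := div_pos (hpos w hw) (Complex.normSq_pos.2 h2)
      have := hpos w hw
      positivity
    rw [phiLune, show 1 + ((w ^ 2 - 1) / (2 * w)) ^ 2 = ((w ^ 2 + 1) / (2 * w)) ^ 2 by
      field_simp; ring, sq_cpow_half h3]
    field_simp
    ring
  · have h2 := cpow_half_sq (1 + z ^ 2)
    -- With `Re z > -1` this forces `x² + 2x - 1 > 0`, that is `x > √2 - 1`.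
    have h3 : 2 * (x : ℂ) * z = x ^ 2 - 1 := by
      rw [phiLune] at hzx
      rw [← hzx]
      linear_combination -h2
    have h4 := congrArg Complex.re h3
    simp [pow_two] at h4
    have h5 := (abs_le.1 (Complex.abs_re_le_norm z)).1
    have h6 := mem_disk.1 hz
    nlinarith

theorem radius_phiR {R : ℝ} (h0 : 0 < R) (h1 : R < 1)
    (hR : starPoly (2 * (Real.sqrt 2 - 1)) R = 0) :
    radius (starlikeSub phiR) classF1 = R ∧ radius (starlikeSub phiR) {extremal} = R := by
  have hsq : Real.sqrt 2 ^ 2 = 2 := Real.sq_sqrt (by norm_num)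
  have hs1 : 1 < Real.sqrt 2 := by rw [Real.lt_sqrt] <;> norm_num
  have hs2 : Real.sqrt 2 < 3 / 2 := by rw [Real.sqrt_lt'] <;> norm_num
  obtain ⟨k, hk⟩ : ∃ k : ℝ, k = Real.sqrt 2 + 1 := ⟨_, rfl⟩
  have hkR : kR = (k : ℂ) := by rw [kR, hk]
  have hk0 : (k : ℂ) ≠ 0 := by
    have : k ≠ 0 := by linarith
    exact_mod_cast this
  have hk2 : k ^ 2 * (3 - 2 * Real.sqrt 2) = 1 := by rw [hk]; nlinarith
  have hden : ∀ z : ℂ, ‖z‖ < 1 → (k : ℂ) ^ 2 - k * z ≠ 0 := by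
    intro z hz h
    have h2 : z = k := by
      apply mul_left_cancel₀ hk0
      linear_combination -h
    rw [h2, Complex.norm_real, Real.norm_eq_abs, abs_of_pos (by linarith)] at hz
    linarith
  have hne : ∀ w : ℂ, ‖w - 1‖ < 1 - 2 * (Real.sqrt 2 - 1) → w ≠ 0 := fun w hw h => by
    simpa [h] using re_pos_of_norm_sub_one_lt (by linarith) hw
  have hv : ∀ w : ℂ, ‖w - 1‖ < 1 - 2 * (Real.sqrt 2 - 1) → ‖4 * (w - 1) / w ^ 2‖ < 1 := by
    intro w hw
    rw [norm_div, norm_mul, norm_pow, div_lt_one (pow_pos (norm_pos_iff.2 (hne w hw)) 2)]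
    have h2 : 1 - ‖w - 1‖ ≤ ‖w‖ := by
      have := norm_sub_norm_le (1 : ℂ) (1 - w)
      rw [show 1 - (1 - w) = w by ring, norm_sub_rev 1 w] at this
      simpa using this
    norm_num
    have h3 : (1 - ‖w - 1‖) ^ 2 ≤ ‖w‖ ^ 2 := pow_le_pow_left₀ (by linarith) h2 2
    -- `4d < (1 - d)²` holds for `0 ≤ d < 3 - 2√2`, the smaller root of `d² - 6d + 1`.
    nlinarith [norm_nonneg (w - 1)]
  have hs : ∀ w : ℂ, ‖w - 1‖ < 1 - 2 * (Real.sqrt 2 - 1) → 1 + 4 * (w - 1) / w ^ 2 ∈ slitPlane :=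
    fun w hw => Complex.mem_slitPlane_of_norm_lt_one (hv w hw)
  have hlt : ∀ w : ℂ, ‖w - 1‖ < 1 - 2 * (Real.sqrt 2 - 1) →
      ‖(k : ℂ) * w / 2 * ((1 + 4 * (w - 1) / w ^ 2) ^ (1 / 2 : ℂ) - 1)‖ < 1 := by
    intro w hw
    have h2 := re_cpow_half_pos (hs w hw)
    have h3 := cpow_half_sq (1 + 4 * (w - 1) / w ^ 2)
    set s := (1 + 4 * (w - 1) / w ^ 2) ^ (1 / 2 : ℂ)
    -- `φ(z) = w` reads `z² + kwz - k²(w - 1) = 0`. The product of its roots has modulus `k²|w - 1|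
    -- < 1`, and the root chosen is the smaller one.
    have h4 : ‖(k : ℂ) * w / 2 * (s - 1)‖ * ‖(k : ℂ) * w / 2 * (s + 1)‖ < 1 := by
      rw [← norm_mul, show (k : ℂ) * w / 2 * (s - 1) * (k * w / 2 * (s + 1)) =
        (k : ℂ) ^ 2 * w ^ 2 / 4 * (s ^ 2 - 1) by ring, h3,
        show (k : ℂ) ^ 2 * w ^ 2 / 4 * (1 + 4 * (w - 1) / w ^ 2 - 1) = (k : ℂ) ^ 2 * (w - 1) by
          have := hne w hw
          field_simp
          ring, norm_mul, norm_pow, Complex.norm_real, Real.norm_eq_abs, sq_abs, ← hk2]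
      apply mul_lt_mul_of_pos_left _ (by nlinarith)
      linarith
    have h5 : ‖(k : ℂ) * w / 2 * (s - 1)‖ ≤ ‖(k : ℂ) * w / 2 * (s + 1)‖ := by
      rw [norm_mul, norm_mul]
      exact mul_le_mul_of_nonneg_left (norm_sub_one_lt_norm_add_one h2).le (norm_nonneg _)
    nlinarith [norm_nonneg ((k : ℂ) * w / 2 * (s - 1))]
  refine radius_starlikeSub
    (fun w => (k : ℂ) * w / 2 * ((1 + 4 * (w - 1) / w ^ 2) ^ (1 / 2 : ℂ) - 1)) (by linarith)
    h0 h1 hR (fun w hw => ?_) (by simp) hlt (fun w hw => ?_) fun x hx hx1 z hz hzx => ?_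
  · have h2 : DifferentiableAt ℂ (fun w : ℂ => 1 + 4 * (w - 1) / w ^ 2) w :=
      (DifferentiableAt.div (c := fun w : ℂ => 4 * (w - 1)) (d := fun w : ℂ => w ^ 2)
        (by fun_prop) (by fun_prop) (pow_ne_zero 2 (hne w hw))).const_add 1
    have h3 : DifferentiableAt ℂ (fun w : ℂ => (k : ℂ) * w / 2) w := by fun_prop
    exact h3.mul ((h2.cpow_const (hs w hw)).sub_const 1)
  · have h2 := hden _ (hlt w hw)
    have h3 := cpow_half_sq (1 + 4 * (w - 1) / w ^ 2)
    set s := (1 + 4 * (w - 1) / w ^ 2) ^ (1 / 2 : ℂ)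
    have h4 : w ^ 2 * s ^ 2 = w ^ 2 + 4 * (w - 1) := by
      rw [h3]
      have := hne w hw
      field_simp
    simp only [phiR, hkR]
    rw [← eq_sub_iff_add_eq', div_eq_iff h2]
    linear_combination (k : ℂ) ^ 2 / 4 * h4
  · have h2 := hden z (mem_disk.1 hz)
    rw [phiR, hkR, ← eq_sub_iff_add_eq', div_eq_iff h2] at hzx
    have h3 : z * z + (k : ℂ) * x * z - k * k * (x - 1) = 0 := by linear_combination hzx
    have hre := congrArg Complex.re h3
    have him := congrArg Complex.im h3
    simp at hre him
    have h4 : z.re ^ 2 + z.im ^ 2 < 1 := by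
      have h5 := Complex.sq_norm z
      rw [Complex.normSq_apply] at h5
      nlinarith [mem_disk.1 hz, norm_nonneg z]
    -- A real root needs a nonnegative discriminant `k²((x + 2)² - 8)`; a nonreal one has `|z|² =
    -- k²(1 - x) > 1`.
    rcases mul_eq_zero.1 (show z.im * (2 * z.re + k * x) = 0 by linarith) with h | h
    · rw [h] at hre
      have h6 : (2 * z.re + k * x) ^ 2 = k ^ 2 * ((x + 2) ^ 2 - 8) := by nlinarith
      have h7 : (x + 2) ^ 2 < 8 := by nlinarith
      nlinarith [sq_nonneg (2 * z.re + k * x), mul_pos (show 0 < k ^ 2 by nlinarith) (sub_pos.2 h7)]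
    · have h6 : z.re ^ 2 + z.im ^ 2 = k ^ 2 * (1 - x) := by
        have : k * x = -2 * z.re := by linarith
        rw [this] at hre
        linarith
      have h7 : k ^ 2 * (3 - 2 * Real.sqrt 2) < k ^ 2 * (1 - x) :=
        mul_lt_mul_of_pos_left (by linarith) (by nlinarith)
      linarith

theorem cosh_eq_of_sq_eq {a b : ℂ} (h : a ^ 2 = b ^ 2) : Complex.cosh a = Complex.cosh b := by
  rcases sq_eq_sq_iff_eq_or_eq_neg.1 h with h | h
  · rw [h]
  · rw [h, Complex.cosh_neg]

/-- `v ↦ cosh √v` is entire. -/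
theorem differentiable_cosh_cpow_half :
    Differentiable ℂ (fun v : ℂ => Complex.cosh (v ^ (1 / 2 : ℂ))) := by
  have hne : ∀ v : ℂ, v ≠ 0 →
      DifferentiableAt ℂ (fun v : ℂ => Complex.cosh (v ^ (1 / 2 : ℂ))) v := by
    intro v hv
    rcases Complex.mem_slitPlane_or_neg_mem_slitPlane hv with h | h
    · exact (DifferentiableAt.cpow_const differentiableAt_id h).ccosh
    -- Across the cut `i√(-v)` is another root of `v`, and `cosh` is even.
    · have he : (fun v : ℂ => Complex.cosh (v ^ (1 / 2 : ℂ))) =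
          fun v : ℂ => Complex.cosh (I * (-v) ^ (1 / 2 : ℂ)) := by
        funext w
        apply cosh_eq_of_sq_eq
        rw [mul_pow, cpow_half_sq, cpow_half_sq, I_sq]
        ring
      rw [he]
      exact ((DifferentiableAt.cpow_const differentiableAt_id.neg h).const_mul I).ccosh
  intro v
  by_cases hv : v = 0
  · rw [hv]
    refine (Complex.analyticAt_of_differentiable_on_punctured_nhds_of_continuousAt ?_
      ?_).differentiableAt
    · filter_upwards [self_mem_nhdsWithin] with w hw using hne w hw
    · exact Complex.continuous_cosh.continuousAt.comp
        (Complex.continuousAt_cpow_const_of_re_pos (by simp) (by norm_num))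
  · exact hne v hv

theorem re_cosh_pos {s : ℂ} (hs : |s.im| < Real.pi / 2) : 0 < (Complex.cosh s).re := by
  have h : (Complex.cosh s).re = Real.cosh s.re * Real.cos s.im := by
    conv_lhs => rw [← Complex.re_add_im s, Complex.cosh_add, Complex.cosh_mul_I,
      Complex.sinh_mul_I, ← Complex.ofReal_sin, ← Complex.ofReal_cos, ← Complex.ofReal_sinh,
      ← Complex.ofReal_cosh]
    simp only [Complex.add_re, Complex.mul_re, Complex.mul_im, Complex.ofReal_re,
      Complex.ofReal_im, Complex.I_re, Complex.I_im]
    ring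
  rw [h]
  exact mul_pos (Real.cosh_pos _) (Real.cos_pos_of_mem_Ioo (abs_lt.1 hs |>.imp (by
    intro h; linarith) id))

/-- The quotient is `tanh²(s/2)`, so its root is `±tanh(s/2)` and the logarithm is `±s`; squaring
removes the sign. The bound on `Im s` keeps `log (exp s) = s`. -/
theorem log_sq_cosh {s : ℂ} (hs : |s.im| < Real.pi / 2) :
    Complex.log ((1 + ((Complex.cosh s - 1) / (Complex.cosh s + 1)) ^ (1 / 2 : ℂ)) /
      (1 - ((Complex.cosh s - 1) / (Complex.cosh s + 1)) ^ (1 / 2 : ℂ))) ^ 2 = s ^ 2 := by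
  have hs' := abs_lt.1 hs
  have hpi := Real.pi_pos
  have hc := re_cosh_pos hs
  have hsq := cpow_half_sq ((Complex.cosh s - 1) / (Complex.cosh s + 1))
  set ζ := ((Complex.cosh s - 1) / (Complex.cosh s + 1)) ^ (1 / 2 : ℂ)
  have he0 := Complex.exp_ne_zero s
  have he1 : Complex.exp s + 1 ≠ 0 := fun h => by
    have h1 := congrArg Complex.re h
    have h2 : 0 < (Complex.exp s).re := by
      rw [Complex.exp_re]
      exact mul_pos (Real.exp_pos _) (Real.cos_pos_of_mem_Ioo ⟨by linarith, hs'.2⟩)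
    simp only [Complex.add_re, Complex.one_re, Complex.zero_re] at h1
    linarith
  have hlog : Complex.log (Complex.exp s) = s :=
    Complex.log_exp (by linarith) (by linarith)
  have hlog' : Complex.log (Complex.exp s)⁻¹ = -s := by
    rw [← Complex.exp_neg]
    apply Complex.log_exp <;> simp <;> linarith
  have hT : (Complex.cosh s - 1) / (Complex.cosh s + 1) =
      ((Complex.exp s - 1) / (Complex.exp s + 1)) ^ 2 := by
    have h2 : Complex.cosh s + 1 ≠ 0 := fun h => by
      have h1 := congrArg Complex.re h
      simp only [Complex.add_re, Complex.one_re, Complex.zero_re] at h1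
      linarith
    have h3 : 2 * Complex.exp s * Complex.cosh s = Complex.exp s ^ 2 + 1 := by
      rw [Complex.cosh, Complex.exp_neg]
      field_simp
    rw [div_pow, div_eq_div_iff h2 (pow_ne_zero 2 he1)]
    linear_combination 2 * h3
  rw [hT] at hsq
  rcases sq_eq_sq_iff_eq_or_eq_neg.1 hsq with h | h
  · have : (1 + ζ) / (1 - ζ) = Complex.exp s := by
      rw [h]
      have h1 : 1 - (Complex.exp s - 1) / (Complex.exp s + 1) = 2 / (Complex.exp s + 1) := by
        field_simp; ring
      rw [h1]
      field_simp
      ring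
    rw [this, hlog]
  · have : (1 + ζ) / (1 - ζ) = (Complex.exp s)⁻¹ := by
      rw [h]
      have h1 : 1 + -((Complex.exp s - 1) / (Complex.exp s + 1)) = 2 / (Complex.exp s + 1) := by
        field_simp; ring
      have h2 : 1 - -((Complex.exp s - 1) / (Complex.exp s + 1)) =
          2 * Complex.exp s / (Complex.exp s + 1) := by
        field_simp; ring
      rw [h1, h2]
      field_simp
    rw [this, hlog', neg_sq]

theorem radius_phiP {R : ℝ} (h0 : 0 < R) (h1 : R < 1) (hR : starPoly (1 / 2) R = 0) :
    radius (starlikeSub phiP) classF1 = R ∧ radius (starlikeSub phiP) {extremal} = R := by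
  have hpi := Real.pi_pos
  have hpic : (Real.pi : ℂ) ≠ 0 := by exact_mod_cast hpi.ne'
  have him : ∀ w : ℂ, ‖w - 1‖ < 1 - 1 / 2 →
      |(((Real.pi : ℂ) ^ 2 / 2 * (w - 1)) ^ (1 / 2 : ℂ)).im| < Real.pi / 2 := by
    intro w hw
    refine (Complex.abs_im_le_norm _).trans_lt ?_
    apply lt_of_pow_lt_pow_left₀ 2 (by positivity)
    rw [← norm_pow, cpow_half_sq, norm_mul, norm_div, norm_pow, Complex.norm_real,
      Real.norm_eq_abs, sq_abs]
    norm_num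
    norm_num at hw
    nlinarith [sq_pos_of_pos hpi]
  have hne : ∀ w : ℂ, ‖w - 1‖ < 1 - 1 / 2 →
      Complex.cosh (((Real.pi : ℂ) ^ 2 / 2 * (w - 1)) ^ (1 / 2 : ℂ)) + 1 ≠ 0 := by
    intro w hw h
    have h1 := congrArg Complex.re h
    have h2 := re_cosh_pos (him w hw)
    simp only [Complex.add_re, Complex.one_re, Complex.zero_re] at h1
    linarith
  refine radius_starlikeSub
    (fun w => (Complex.cosh (((Real.pi : ℂ) ^ 2 / 2 * (w - 1)) ^ (1 / 2 : ℂ)) - 1) /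
      (Complex.cosh (((Real.pi : ℂ) ^ 2 / 2 * (w - 1)) ^ (1 / 2 : ℂ)) + 1)) (by norm_num)
    h0 h1 hR (fun w hw => ?_) (by simp) (fun w hw => ?_) (fun w hw => ?_)
    fun x hx hx1 z hz hzx => ?_
  · have h2 : DifferentiableAt ℂ
        (fun w : ℂ => Complex.cosh (((Real.pi : ℂ) ^ 2 / 2 * (w - 1)) ^ (1 / 2 : ℂ))) w :=
      DifferentiableAt.comp (g := fun v : ℂ => Complex.cosh (v ^ (1 / 2 : ℂ))) w
        (differentiable_cosh_cpow_half _) (by fun_prop)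
    exact (h2.sub_const 1).div (h2.add_const 1) (hne w hw)
  · rw [norm_div, div_lt_one (norm_pos_iff.2 (hne w hw))]
    exact norm_sub_one_lt_norm_add_one (re_cosh_pos (him w hw))
  · rw [phiP, log_sq_cosh (him w hw), cpow_half_sq]
    field_simp
    ring
  · have hζ : z ^ (1 / 2 : ℂ) ∈ disk := by
      rw [mem_disk]
      apply lt_of_pow_lt_pow_left₀ 2 zero_le_one
      rw [← norm_pow, cpow_half_sq, one_pow]
      exact mem_disk.1 hz
    have harg := Complex.abs_arg_lt_pi_div_two_iff.2 (Or.inl (re_cayley_pos hζ))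
    rw [← Complex.log_im] at harg
    rw [phiP] at hzx
    set L := Complex.log ((1 + z ^ (1 / 2 : ℂ)) / (1 - z ^ (1 / 2 : ℂ)))
    have h2 : L * L = ((Real.pi ^ 2 * (x - 1) / 2 : ℝ) : ℂ) := by
      push_cast
      rw [← hzx]
      field_simp
      ring
    have hre := congrArg Complex.re h2
    rw [Complex.mul_re, Complex.ofReal_re] at hre
    -- Since `Re L² ≥ -(Im L)² > -π²/4`, the value `x` exceeds `1/2`.
    have h3 : L.im ^ 2 < (Real.pi / 2) ^ 2 := by
      rw [← sq_abs]
      exact pow_lt_pow_left₀ harg (abs_nonneg _) two_ne_zero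
    nlinarith [sq_nonneg L.re, sq_pos_of_pos hpi]

/-! ### The lemniscate class -/

/-- The sharp upper bound of `Re s_f` on the circle `|z| = t` over the class `F₁`. -/
noncomputable def upperBound (t : ℝ) : ℝ := 1 + t / (2 + t) + 4 * t / (1 - t ^ 2)

/-- The polynomial whose smallest positive root is the radius of lemniscate starlikeness. -/
noncomputable def lemniscatePoly (r : ℝ) : ℝ :=
  (2 - Real.sqrt 2) * r ^ 3 - (2 + 2 * Real.sqrt 2) * r ^ 2
    + (Real.sqrt 2 - 10) * r + 2 * Real.sqrt 2 - 2

theorem lemniscatePoly_eq {r : ℝ} (h0 : 0 ≤ r) (h1 : r < 1) :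
    lemniscatePoly r = (Real.sqrt 2 - upperBound r) * ((2 + r) * (1 - r ^ 2)) := by
  have h2 : 2 + r ≠ 0 := by linarith
  have h3 : 1 - r ^ 2 ≠ 0 := by nlinarith
  rw [lemniscatePoly, upperBound]
  field_simp
  ring

theorem lemniscatePoly_factor_pos {r : ℝ} (h0 : 0 ≤ r) (h1 : r < 1) :
    0 < (2 + r) * (1 - r ^ 2) :=
  mul_pos (by linarith) (by nlinarith)

theorem strictMonoOn_upperBound : StrictMonoOn upperBound (Ico 0 1) := by
  intro s hs t ht hst
  have h1 := strictMonoOn_div_one_sub_sq hs ht hst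
  have h2 : s / (2 + s) ≤ t / (2 + t) := by
    rw [div_le_div_iff₀ (by linarith [hs.1]) (by linarith [ht.1])]
    nlinarith
  simp only at h1
  rw [upperBound, upperBound]
  linarith

theorem upperBound_of_root {r : ℝ} (h0 : 0 ≤ r) (h1 : r < 1) (h : lemniscatePoly r = 0) :
    upperBound r = Real.sqrt 2 := by
  rw [lemniscatePoly_eq h0 h1] at h
  have := (mul_eq_zero.1 h).resolve_right (lemniscatePoly_factor_pos h0 h1).ne'
  linarith

theorem exists_root_lemniscatePoly :
    ∃ R, |R - 0.0918| < 0.0001 ∧ lemniscatePoly R = 0 := by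
  have hc : ContinuousOn lemniscatePoly (Icc 0.0917 0.0919) := by
    unfold lemniscatePoly; fun_prop
  have hs1 : 1.41421 < Real.sqrt 2 := by rw [Real.lt_sqrt] <;> norm_num
  have hs2 : Real.sqrt 2 < 1.41422 := by rw [Real.sqrt_lt'] <;> norm_num
  have := intermediate_value_Ioo' (by norm_num) hc
  obtain ⟨R, hR, h⟩ := this (show (0 : ℝ) ∈ _ from
    ⟨by unfold lemniscatePoly; nlinarith, by unfold lemniscatePoly; nlinarith⟩)
  refine ⟨R, ?_, h⟩
  rw [abs_lt]
  constructor <;> linarith [hR.1, hR.2]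

theorem isLeast_root_lemniscatePoly {R : ℝ} (h0 : 0 < R) (h1 : R < 1)
    (hR : lemniscatePoly R = 0) : IsLeast {r : ℝ | 0 < r ∧ lemniscatePoly r = 0} R := by
  refine ⟨⟨h0, hR⟩, fun s hs => ?_⟩
  by_contra! hlt
  have h2 := strictMonoOn_upperBound ⟨hs.1.le, hlt.trans h1⟩ ⟨h0.le, h1⟩ hlt
  rw [upperBound_of_root h0.le h1 hR, upperBound_of_root hs.1.le (hlt.trans h1) hs.2] at h2
  exact lt_irrefl _ h2

/-- The image of the circle `|z| = t` under `z ↦ 1 + z / (2 + z)` lies on a circle. -/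
theorem norm_one_add_div_two_add_sub {z : ℂ} (hz : z ∈ disk) :
    ‖1 + z / (2 + z) - (((4 - 2 * ‖z‖ ^ 2) / (4 - ‖z‖ ^ 2) : ℝ) : ℂ)‖
      ≤ 2 * ‖z‖ / (4 - ‖z‖ ^ 2) := by
  have h1 := mem_disk.1 hz
  have h2 : 0 < 4 - ‖z‖ ^ 2 := by nlinarith [norm_nonneg z]
  have h3 := Factorization.two_add_ne_zero hz
  have h4 : (4 - (‖z‖ : ℂ) ^ 2) ≠ 0 := by
    rw [show (4 - (‖z‖ : ℂ) ^ 2) = ((4 - ‖z‖ ^ 2 : ℝ) : ℂ) by push_cast; ring]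
    exact_mod_cast h2.ne'
  -- The factor `(2 + z̄)/(2 + z)` has modulus `1`.
  have h5 : 1 + z / (2 + z) - (((4 - 2 * ‖z‖ ^ 2) / (4 - ‖z‖ ^ 2) : ℝ) : ℂ) =
      (2 * z * (2 + conj z) / (2 + z)) / (4 - (‖z‖ : ℂ) ^ 2) := by
    have h6 := Complex.mul_conj' z
    push_cast
    field_simp
    linear_combination (-2) * h6
  rw [h5, norm_div, norm_div, norm_mul, norm_mul,
    show (4 - (‖z‖ : ℂ) ^ 2) = ((4 - ‖z‖ ^ 2 : ℝ) : ℂ) by push_cast; ring, Complex.norm_real,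
    Real.norm_eq_abs, abs_of_pos h2,
    show ‖2 + conj z‖ = ‖2 + z‖ by
      rw [← RCLike.norm_conj (2 + z), map_add, map_ofNat],
    mul_div_cancel_right₀ _ (norm_ne_zero_iff.2 h3)]
  simp

theorem sq_lt_of_sq_sub_add_sq_lt {a b x y : ℝ} (hb : b ^ 2 = 2) (ha : 19 / 20 ≤ a)
    (ha1 : a ≤ 1) (hb1 : b < 1.42) (hx : x < b)
    (h : (x - a) ^ 2 + y ^ 2 < (b - a) ^ 2) :
    (x ^ 2 + y ^ 2) ^ 2 + 2 * (x ^ 2 + y ^ 2) < 4 * x ^ 2 := by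
  have ht : 0 < b - x := by linarith
  have hN : x ^ 2 + y ^ 2 < 2 - 2 * a * (b - x) := by linarith
  have hN0 : 0 ≤ x ^ 2 + y ^ 2 := by positivity
  obtain ⟨M, hM⟩ : ∃ M, M = 2 - 2 * a * (b - x) := ⟨_, rfl⟩
  rw [← hM] at hN
  have hM2 : M ^ 2 + 2 * M - 4 * x ^ 2 =
      (b - x) * (8 * b - 12 * a) - 4 * (1 - a ^ 2) * (b - x) ^ 2 := by
    rw [hM]
    linear_combination -4 * hb
  -- Needs `a ≥ 2b/3`; with `b < 1.42` the bound `19/20` is enough.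
  have e1 : (b - x) * (8 * b - 12 * a) ≤ 0 :=
    mul_nonpos_of_nonneg_of_nonpos ht.le (by linarith)
  have e2 : 0 ≤ 4 * (1 - a ^ 2) * (b - x) ^ 2 := by
    have : 0 ≤ 1 - a ^ 2 := by nlinarith
    positivity
  have hM4 : (x ^ 2 + y ^ 2) ^ 2 < M ^ 2 := pow_lt_pow_left₀ hN hN0 two_ne_zero
  linarith

/-- The disks centred in `[19 / 20, 1]` that touch the lemniscate `|w ^ 2 - 1| = 1` at `√2` lie
inside it. -/
theorem mem_lemniscate_of_norm_sub_lt {w : ℂ} {a : ℝ} (ha : 19 / 20 ≤ a) (ha1 : a ≤ 1)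
    (h : ‖w - a‖ < Real.sqrt 2 - a) : 0 < w.re ∧ ‖w ^ 2 - 1‖ < 1 := by
  have hs2 : Real.sqrt 2 < 1.42 := by rw [Real.sqrt_lt'] <;> norm_num
  have hb := (Complex.abs_re_le_norm (w - a)).trans_lt h
  rw [abs_lt, Complex.sub_re, Complex.ofReal_re] at hb
  have h2 : ‖w - a‖ ^ 2 < (Real.sqrt 2 - a) ^ 2 := pow_lt_pow_left₀ h (norm_nonneg _) two_ne_zero
  refine ⟨by linarith [hb.1], ?_⟩
  apply lt_of_pow_lt_pow_left₀ 2 zero_le_one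
  rw [Complex.sq_norm, Complex.normSq_apply] at h2 ⊢
  have h3 := sq_lt_of_sq_sub_add_sq_lt (x := w.re) (y := w.im) (Real.sq_sqrt (by norm_num)) ha ha1
    hs2 (by linarith [hb.2]) (by simpa [pow_two] using h2)
  simp only [pow_two, Complex.sub_re, Complex.mul_re, Complex.one_re, Complex.sub_im,
    Complex.mul_im, Complex.one_im] at h3 ⊢
  linarith

/-- A disk centred at `1` would have to use the larger term `t/(2 - t)`. The moving centre gives
`t/(2 + t)`, and `R < 1/10` keeps it in `[19/20, 1]`. -/
theorem starQuot_mem_lemniscate {f p q : ℂ → ℂ} (h : Factorization f p q) {R : ℝ}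
    (h0 : 0 < R) (h1 : R < 1 / 10) (hR : lemniscatePoly R = 0) {z : ℂ} (hz : ‖z‖ < R) :
    0 < (starQuot f z).re ∧ ‖starQuot f z ^ 2 - 1‖ < 1 := by
  have hzd : z ∈ disk := mem_disk.2 (by linarith)
  have hn := norm_nonneg z
  have h2 : 0 < 4 - ‖z‖ ^ 2 := by nlinarith
  have h3 := h.norm_starQuot_sub_le hzd
  have h4 := norm_one_add_div_two_add_sub hzd
  have h5 := strictMonoOn_upperBound ⟨hn, by linarith⟩ ⟨h0.le, by linarith⟩ hz
  rw [upperBound_of_root h0.le (by linarith) hR, upperBound] at h5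
  refine mem_lemniscate_of_norm_sub_lt (a := (4 - 2 * ‖z‖ ^ 2) / (4 - ‖z‖ ^ 2)) ?_ ?_ ?_
  · rw [le_div_iff₀ h2]; nlinarith
  · rw [div_le_one h2]; nlinarith
  · have h6 : (4 - 2 * ‖z‖ ^ 2) / (4 - ‖z‖ ^ 2) + 2 * ‖z‖ / (4 - ‖z‖ ^ 2) =
        1 + ‖z‖ / (2 + ‖z‖) := by
      have : 2 + ‖z‖ ≠ 0 := by positivity
      field_simp
      ring
    have h7 := norm_add_le (starQuot f z - (1 + z / (2 + z)))
      (1 + z / (2 + z) - (((4 - 2 * ‖z‖ ^ 2) / (4 - ‖z‖ ^ 2) : ℝ) : ℂ))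
    rw [sub_add_sub_cancel] at h7
    linarith

theorem phiL_ne_of_sqrt_two_lt {x : ℝ} (hx : Real.sqrt 2 < x) {z : ℂ} (hz : z ∈ disk) :
    phiL z ≠ x := by
  intro h
  have h1 := cpow_half_sq (1 + z)
  rw [← phiL, h] at h1
  have h2 := norm_add_le (1 : ℂ) z
  rw [← h1, norm_pow, Complex.norm_real, Real.norm_eq_abs, sq_abs, norm_one] at h2
  have h3 := mem_disk.1 hz
  have hsq : Real.sqrt 2 ^ 2 = 2 := Real.sq_sqrt (by norm_num)
  nlinarith [Real.sqrt_nonneg 2]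

theorem radius_phiL {R : ℝ} (h0 : 0 < R) (h1 : R < 1 / 10) (hR : lemniscatePoly R = 0) :
    radius (starlikeSub phiL) classF1 = R ∧ radius (starlikeSub phiL) {extremal} = R := by
  refine radius_classF1_eq h0.le (by linarith) (fun f p q hf h r hr hrR => ?_)
    fun r hRr hr hmem => ?_
  · refine dilate_mem_starlikeSub (U := {w | 0 < w.re ∧ ‖w ^ 2 - 1‖ < 1})
      (ψ := fun w => w ^ 2 - 1) hf h hr (by linarith)
      (fun z hz => starQuot_mem_lemniscate h h0 h1 hR (hz.trans hrR)) (fun w _ => by fun_prop)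
      (by simp) (fun w hw => hw.2) fun w hw => ?_
    rw [phiL, add_sub_cancel, sq_cpow_half hw.1]
  · obtain ⟨t, ht1, ht2⟩ := exists_between hRr
    have hr0 : 0 < r := h0.trans hRr
    have ht0 : 0 < t := h0.trans ht1
    have hrc : (r : ℂ) ≠ 0 := by exact_mod_cast hr0.ne'
    have hlt := strictMonoOn_upperBound ⟨h0.le, by linarith⟩ ⟨ht0.le, ht2.trans hr⟩ ht1
    rw [upperBound_of_root h0.le (by linarith) hR] at hlt
    have hz : ((t / r : ℝ) : ℂ) ∈ disk := by
      rw [mem_disk, Complex.norm_real, Real.norm_eq_abs, abs_div, abs_of_pos ht0,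
        abs_of_pos hr0, div_lt_one hr0]
      exact ht2
    obtain ⟨ω, -, hω, -, hsub⟩ := hmem.2.2
    apply phiL_ne_of_sqrt_two_lt hlt (hω hz)
    rw [← hsub _ hz, starQuot_dilate hr0, upperBound, ← starQuot_extremal
      (by rw [abs_of_pos ht0]; exact ht2.trans hr)]
    congr 1
    push_cast
    field_simp

/-! ### Numerical values and conclusion -/

theorem abs_sin_one_sub_lt : |Real.sin 1 - 0.841471| < 0.000001 := by
  -- The imaginary part of the Taylor sum of `e^i`; ten terms leave an error of at most `11/(10·10!)
  -- < 10⁻⁶`.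
  have h := Complex.exp_bound (x := I) (by simp) (n := 10) (by norm_num)
  have h1 := (Complex.abs_im_le_norm _).trans h
  simp only [Finset.sum_range_succ, Finset.sum_range_zero, Complex.sub_im, Complex.add_im] at h1
  have e : (Complex.exp I).im = Real.sin 1 := by
    have := Complex.exp_ofReal_mul_I_im 1
    simpa using this
  have i2 : I ^ 2 = -1 := I_sq
  have i3 : I ^ 3 = -I := by rw [pow_succ, i2]; ring
  have i4 : I ^ 4 = 1 := I_pow_four
  have i5 : I ^ 5 = I := by rw [pow_succ, i4]; ring
  have i6 : I ^ 6 = -1 := by rw [pow_succ, i5, ← pow_two, i2]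
  have i7 : I ^ 7 = -I := by rw [pow_succ, i6]; ring
  have i8 : I ^ 8 = 1 := by rw [pow_succ, i7, neg_mul, I_mul_I, neg_neg]
  have i9 : I ^ 9 = I := by rw [pow_succ, i8]; ring
  rw [e, i2, i3, i4, i5, i6, i7, i8, i9] at h1
  norm_num [Nat.factorial] at h1
  rw [abs_le] at h1
  rw [abs_lt]
  constructor <;> linarith [h1.1, h1.2]

end CloseToStar

open CloseToStar

theorem theorem1 :
    -- the function `f₁` belongs to the class
    extremal ∈ classF1 ∧
    -- starlikeness of order `α`
    (∀ α : ℝ, 0 ≤ α → α < 1 →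
      IsLeast {r : ℝ | 0 < r ∧
          (α - 2) * r ^ 3 - (2 * α + 2) * r ^ 2 + (10 - α) * r + 2 * α - 2 = 0}
        (radius (starlikeOfOrder α) classF1) ∧
      radius (starlikeOfOrder α) {extremal} = radius (starlikeOfOrder α) classF1) ∧
    -- lemniscate starlikeness
    (IsLeast {r : ℝ | 0 < r ∧
          (2 - Real.sqrt 2) * r ^ 3 - (2 + 2 * Real.sqrt 2) * r ^ 2
            + (Real.sqrt 2 - 10) * r + 2 * Real.sqrt 2 - 2 = 0}
        (radius (starlikeSub phiL) classF1) ∧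
      |radius (starlikeSub phiL) classF1 - 0.0918| < 0.0001 ∧
      radius (starlikeSub phiL) {extremal} = radius (starlikeSub phiL) classF1) ∧
    -- parabolic starlikeness
    (radius (starlikeSub phiP) classF1 = radius (starlikeOfOrder (1 / 2)) classF1 ∧
      |radius (starlikeSub phiP) classF1 - 0.1092| < 0.0001 ∧
      radius (starlikeSub phiP) {extremal} = radius (starlikeSub phiP) classF1) ∧
    -- exponential starlikeness
    (radius (starlikeSub phiE) classF1 = radius (starlikeOfOrder (1 / Real.exp 1)) classF1 ∧
      |radius (starlikeSub phiE) classF1 - 0.1370| < 0.0001 ∧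
      radius (starlikeSub phiE) {extremal} = radius (starlikeSub phiE) classF1) ∧
    -- sine starlikeness
    (radius (starlikeSub phiSin) classF1 = radius (starlikeOfOrder (1 - Real.sin 1)) classF1 ∧
      |radius (starlikeSub phiSin) classF1 - 0.17969| < 0.00001 ∧
      radius (starlikeSub phiSin) {extremal} = radius (starlikeSub phiSin) classF1) ∧
    -- lune starlikeness
    (radius (starlikeSub phiLune) classF1 = radius (starlikeOfOrder (Real.sqrt 2 - 1)) classF1 ∧
      |radius (starlikeSub phiLune) classF1 - 0.12734| < 0.00001 ∧
      radius (starlikeSub phiLune) {extremal} = radius (starlikeSub phiLune) classF1) ∧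
    -- starlikeness associated with the rational function
    (radius (starlikeSub phiR) classF1
        = radius (starlikeOfOrder (2 * (Real.sqrt 2 - 1))) classF1 ∧
      |radius (starlikeSub phiR) classF1 - 0.0380| < 0.0001 ∧
      radius (starlikeSub phiR) {extremal} = radius (starlikeSub phiR) classF1) ∧
    -- cardioid starlikeness
    (radius (starlikeSub phiC) classF1 = radius (starlikeOfOrder (1 / 3)) classF1 ∧
      |radius (starlikeSub phiC) classF1 - 0.14418| < 0.00001 ∧
      radius (starlikeSub phiC) {extremal} = radius (starlikeSub phiC) classF1) := by
  
  have hsq1 : 1.4142135 < Real.sqrt 2 := by rw [Real.lt_sqrt] <;> norm_num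
  have hsq2 : Real.sqrt 2 < 1.4142136 := by rw [Real.sqrt_lt'] <;> norm_num
  have hsin := abs_lt.1 abs_sin_one_sub_lt
  have he1 : 0.367879 < 1 / Real.exp 1 := by
    rw [one_div, ← Real.exp_neg]; linarith [Real.exp_neg_one_gt_d9]
  have he2 : 1 / Real.exp 1 < 0.36788 := by
    rw [one_div, ← Real.exp_neg]; linarith [Real.exp_neg_one_lt_d9]
  refine ⟨extremal_mem_classF1, fun α hα hα1 => ?_, ?_, ?_, ?_, ?_, ?_, ?_, ?_⟩
  · obtain ⟨R, h0, h1, hR⟩ := exists_root_starPoly hα1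
    obtain ⟨e1, e2⟩ := radius_starlikeOfOrder hα h0 h1 hR
    rw [e1, e2]
    exact ⟨isLeast_root_starPoly h0 h1 hR, rfl⟩
  · obtain ⟨R, hR1, hR⟩ := exists_root_lemniscatePoly
    have h := abs_lt.1 hR1
    have h0 : 0 < R := by linarith [h.1]
    obtain ⟨e1, e2⟩ := radius_phiL h0 (by linarith [h.2]) hR
    rw [e1, e2]
    exact ⟨isLeast_root_lemniscatePoly h0 (by linarith [h.2]) hR, hR1, rfl⟩
  · obtain ⟨R, h0, h1, hR⟩ := exists_root_starPoly (α := 1 / 2) (by linarith)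
    rw [(radius_phiP h0 h1 hR).1, (radius_phiP h0 h1 hR).2,
      (radius_starlikeOfOrder (by linarith) h0 h1 hR).1]
    exact ⟨rfl, abs_root_starPoly_sub_lt h0 h1 hR (by norm_num) (by norm_num) (by norm_num)
      (by unfold starPoly; linarith) (by unfold starPoly; linarith), rfl⟩
  · obtain ⟨R, h0, h1, hR⟩ := exists_root_starPoly (α := 1 / Real.exp 1) (by linarith)
    rw [(radius_phiE h0 h1 hR).1, (radius_phiE h0 h1 hR).2,
      (radius_starlikeOfOrder (by linarith) h0 h1 hR).1]
    exact ⟨rfl, abs_root_starPoly_sub_lt h0 h1 hR (by norm_num) (by norm_num) (by norm_num)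
      (by unfold starPoly; linarith) (by unfold starPoly; linarith), rfl⟩
  · obtain ⟨R, h0, h1, hR⟩ := exists_root_starPoly (α := 1 - Real.sin 1) (by linarith)
    rw [(radius_phiSin h0 h1 hR).1, (radius_phiSin h0 h1 hR).2,
      (radius_starlikeOfOrder (by linarith) h0 h1 hR).1]
    exact ⟨rfl, abs_root_starPoly_sub_lt h0 h1 hR (by norm_num) (by norm_num) (by norm_num)
      (by unfold starPoly; linarith) (by unfold starPoly; linarith), rfl⟩
  · obtain ⟨R, h0, h1, hR⟩ := exists_root_starPoly (α := Real.sqrt 2 - 1) (by linarith)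
    rw [(radius_phiLune h0 h1 hR).1, (radius_phiLune h0 h1 hR).2,
      (radius_starlikeOfOrder (by linarith) h0 h1 hR).1]
    exact ⟨rfl, abs_root_starPoly_sub_lt h0 h1 hR (by norm_num) (by norm_num) (by norm_num)
      (by unfold starPoly; linarith) (by unfold starPoly; linarith), rfl⟩
  · obtain ⟨R, h0, h1, hR⟩ := exists_root_starPoly (α := 2 * (Real.sqrt 2 - 1)) (by linarith)
    rw [(radius_phiR h0 h1 hR).1, (radius_phiR h0 h1 hR).2,
      (radius_starlikeOfOrder (by linarith) h0 h1 hR).1]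
    exact ⟨rfl, abs_root_starPoly_sub_lt h0 h1 hR (by norm_num) (by norm_num) (by norm_num)
      (by unfold starPoly; linarith) (by unfold starPoly; linarith), rfl⟩
  · obtain ⟨R, h0, h1, hR⟩ := exists_root_starPoly (α := 1 / 3) (by linarith)
    rw [(radius_phiC h0 h1 hR).1, (radius_phiC h0 h1 hR).2,
      (radius_starlikeOfOrder (by linarith) h0 h1 hR).1]
    exact ⟨rfl, abs_root_starPoly_sub_lt h0 h1 hR (by norm_num) (by norm_num) (by norm_num)
      (by unfold starPoly; linarith) (by unfold starPoly; linarith), rfl⟩
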